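/- Let $X_1,X_2$ be (non-empty) Polish spaces; $\mathcal M(X)$ and $\mathcal P(X)$ denote the finite positive Borel measures and the Borel probability measures on $X$, and $\mathcal P(X_2)$ carries the weak topology. Let $C:X_1\times\mathcal P(X_2)\to(-\infty,+\infty]$ be lower semicontinuous and bounded from below, with $C(x_1,\cdot)$ convex for every $x_1\in X_1$. For $i=1,2$ let $F_i:[0,\infty)\to[0,\infty]$ be convex and lower semicontinuous with $F_i(s)<\infty$ for some $s>0$; put $(F_i)'_\infty:=\lim_{s\to\infty}F_i(s)/s$ and, for $\gamma,\mu\in\mathcal M(X_i)$ with Lebesgue decomposition $\gamma=f\mu+\gamma^\perp$, $\mathcal F_i(\gamma|\mu):=\int F_i(f)\,d\mu+(F_i)'_\infty\,\gamma^\perp(X_i)$ (with $\infty\cdot 0=0$). For $\mu_i\in\mathcal M(X_i)$ and $\boldsymbol\gamma\in\mathcal M(X_1\times X_2)$ with marginals $\gamma_1,\gamma_2$ and disintegration $(\gamma_{x_1})_{x_1\in X_1}$ with respect to $\gamma_1$, put $$\mathcal E_C(\boldsymbol\gamma|\mu_1,\mu_2):=\sum_{i=1}^2\mathcal F_i(\gamma_i|\mu_i)+\int_{X_1}C(x_1,\gamma_{x_1})\,d\gamma_1(x_1),\qquad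 \mathcal E_C(\mu_1,\mu_2):=\inf_{\boldsymbol\gamma\in\mathcal M(X_1\times X_2)}\mathcal E_C(\boldsymbol\gamma|\mu_1,\mu_2).$$ Let $\mu_i\in\mathcal M(X_i)$, $i=1,2$. Assume that the problem is feasible, i.e. $\mathcal E_C(\boldsymbol\gamma|\mu_1,\mu_2)<\infty$ for some $\boldsymbol\gamma\in\mathcal M(X_1\times X_2)$, and coercive, i.e. either $(F_1)'_\infty=(F_2)'_\infty=+\infty$, or $X_1,X_2$ are compact and $(F_1)'_\infty+(F_2)'_\infty+\inf C>0$. Let $\boldsymbol\gamma\in\mathcal M(X_1\times X_2)$ be an optimal plan, i.e. $\mathcal E_C(\boldsymbol\gamma|\mu_1,\mu_2)=\mathcal E_C(\mu_1,\mu_2)$. Then $\boldsymbol\gamma$ is $C$-monotone: there is a measurable set $\Gamma\subseteq X_1$ with $\gamma_1(X_1\setminus\Gamma)=0$ such that for all $N$, all points $x^1,\dots,x^N\in\Gamma$ and all $m_1,\dots,m_N\in\mathcal P(X_2)$ with $\sum_{i=1}^N m_i=\sum_{i=1}^N\gamma_{x^i}$, $$\sum_{i=1}^N C(x^i,\gamma_{x^i})\le\sum_{i=1}^N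 C(x^i,m_i).$$ -/

import Mathlib

open MeasureTheory ProbabilityTheory Filter
open scoped NNReal ENNReal

noncomputable section

namespace WOET

/-- Admissible entropy functions `F : [0,∞) → [0,∞]`. -/
structure IsAdmissible (F : ℝ≥0 → ℝ≥0∞) : Prop where
  convex : ConvexOn ℝ≥0 Set.univ F
  lsc : LowerSemicontinuous F
  proper : ∃ s : ℝ≥0, 0 < s ∧ F s < ∞

/-- The recession constant `F'_∞ = lim_{s → ∞} F(s) / s`. The limit exists in `[0,∞]` for every
admissible `F` (by convexity), so it coincides with the upper limit. -/
def recession (F : ℝ≥0 → ℝ≥0∞) : ℝ≥0∞ :=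
  limsup (fun s : ℝ≥0 => F s / (s : ℝ≥0∞)) atTop

/-- The entropy functional `𝓕(γ|μ) = ∫ F(f) dμ + F'_∞ γ^⊥(X)`, where `γ = f μ + γ^⊥` is the
Lebesgue decomposition of `γ` with respect to `μ`. -/
def entropy {X : Type*} [MeasurableSpace X] (F : ℝ≥0 → ℝ≥0∞) (γ μ : Measure X) : ℝ≥0∞ :=
  ∫⁻ x, F (γ.rnDeriv μ x).toNNReal ∂μ + recession F * γ.singularPart μ Set.univ

/-- The integral `∫ f⁺ dμ - ∫ f⁻ dμ` of an extended real function (used only for functions that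
are bounded from below and finite measures, so that the second term is finite). -/
def eintegral {X : Type*} [MeasurableSpace X] (f : X → EReal) (μ : Measure X) : EReal :=
  ((∫⁻ x, (f x).toENNReal ∂μ : ℝ≥0∞) : EReal) - ((∫⁻ x, (-f x).toENNReal ∂μ : ℝ≥0∞) : EReal)

section

variable {X₁ X₂ : Type*} [TopologicalSpace X₁] [PolishSpace X₁] [MeasurableSpace X₁]
  [BorelSpace X₁] [TopologicalSpace X₂] [PolishSpace X₂] [MeasurableSpace X₂] [BorelSpace X₂]

/-- Cost functions `C : X₁ × 𝓟(X₂) → (-∞,+∞]`: jointly lower semicontinuous (`𝓟(X₂)` carries the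
weak topology), bounded from below by a real number, and convex in the second variable. -/
structure IsWeakCost (C : X₁ → ProbabilityMeasure X₂ → EReal) : Prop where
  lsc : LowerSemicontinuous (fun z : X₁ × ProbabilityMeasure X₂ => C z.1 z.2)
  bddBelow : ∃ b : ℝ, ∀ x p, (b : EReal) ≤ C x p
  convex : ∀ (x : X₁) (s t : ℝ≥0), s + t = 1 → ∀ p q r : ProbabilityMeasure X₂,
    (r : Measure X₂) = s • (p : Measure X₂) + t • (q : Measure X₂) →
      C x r ≤ ((s : ℝ) : EReal) * C x p + ((t : ℝ) : EReal) * C x q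

variable [Nonempty X₂]

/-- The disintegration `(γ_x)` of a finite measure `γ` on `X₁ × X₂` with respect to its first
marginal. -/
def disint (γ : FiniteMeasure (X₁ × X₂)) (x : X₁) : ProbabilityMeasure X₂ :=
  ⟨(γ : Measure (X₁ × X₂)).condKernel x, inferInstance⟩

/-- `𝓔_C(γ|μ₁,μ₂) = 𝓕₁(γ₁|μ₁) + 𝓕₂(γ₂|μ₂) + ∫ C(x, γ_x) dγ₁(x)`. -/
def energy (F₁ F₂ : ℝ≥0 → ℝ≥0∞) (C : X₁ → ProbabilityMeasure X₂ → EReal)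
    (μ₁ : FiniteMeasure X₁) (μ₂ : FiniteMeasure X₂) (γ : FiniteMeasure (X₁ × X₂)) : EReal :=
  ((entropy F₁ (γ : Measure (X₁ × X₂)).fst μ₁ : ℝ≥0∞) : EReal)
    + ((entropy F₂ (γ : Measure (X₁ × X₂)).snd μ₂ : ℝ≥0∞) : EReal)
    + eintegral (fun x => C x (disint γ x)) (γ : Measure (X₁ × X₂)).fst

/-- The optimal value `𝓔_C(μ₁,μ₂)`. -/
def value (F₁ F₂ : ℝ≥0 → ℝ≥0∞) (C : X₁ → ProbabilityMeasure X₂ → EReal)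
    (μ₁ : FiniteMeasure X₁) (μ₂ : FiniteMeasure X₂) : EReal :=
  ⨅ γ : FiniteMeasure (X₁ × X₂), energy F₁ F₂ C μ₁ μ₂ γ

def IsFeasible (F₁ F₂ : ℝ≥0 → ℝ≥0∞) (C : X₁ → ProbabilityMeasure X₂ → EReal)
    (μ₁ : FiniteMeasure X₁) (μ₂ : FiniteMeasure X₂) : Prop :=
  ∃ γ : FiniteMeasure (X₁ × X₂), energy F₁ F₂ C μ₁ μ₂ γ < ⊤

def IsOptimalPlan (F₁ F₂ : ℝ≥0 → ℝ≥0∞) (C : X₁ → ProbabilityMeasure X₂ → EReal)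
    (μ₁ : FiniteMeasure X₁) (μ₂ : FiniteMeasure X₂) (γ : FiniteMeasure (X₁ × X₂)) : Prop :=
  energy F₁ F₂ C μ₁ μ₂ γ = value F₁ F₂ C μ₁ μ₂

/-- The coercivity conditions: both entropies are superlinear, or both spaces are compact and
`(F₁)'_∞ + (F₂)'_∞ + inf C > 0`. -/
def IsCoercive (F₁ F₂ : ℝ≥0 → ℝ≥0∞) (C : X₁ → ProbabilityMeasure X₂ → EReal) : Prop :=
  (recession F₁ = ∞ ∧ recession F₂ = ∞) ∨
    (CompactSpace X₁ ∧ CompactSpace X₂ ∧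
      0 < ((recession F₁ : ℝ≥0∞) : EReal) + ((recession F₂ : ℝ≥0∞) : EReal)
        + ⨅ (x : X₁) (p : ProbabilityMeasure X₂), C x p)

/-- `C`-monotonicity of a finite measure on `X₁ × X₂`. The disintegration is unique up to a null
set of the first marginal, which can be removed from `Γ`, so the choice of version is
immaterial. -/
def IsCMonotone (C : X₁ → ProbabilityMeasure X₂ → EReal) (γ : FiniteMeasure (X₁ × X₂)) : Prop :=
  ∃ Γ : Set X₁, MeasurableSet Γ ∧ (γ : Measure (X₁ × X₂)).fst Γᶜ = 0 ∧
    ∀ (N : ℕ) (x : Fin N → X₁), (∀ i, x i ∈ Γ) → ∀ m : Fin N → ProbabilityMeasure X₂,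
      ∑ i, (m i : Measure X₂) = ∑ i, (disint γ (x i) : Measure X₂) →
        ∑ i, C (x i) (disint γ (x i)) ≤ ∑ i, C (x i) (m i)

end

end WOET

end

/-!
Plans with the same marginals have the same entropies. Hence the disintegration of an optimal plan
minimises `∫ c(x, q_x) dγ₁(x)` among the kernels `q` with the same average, where `c ≥ 0` is `C` up
to an additive constant.

Integrating a characteristic feature map `f : X₂ → ℓ²` turns a probability measure `p` into the
vector `∫ f dp`. This embedding is affine and injective, and a homeomorphism onto its image on
compact sets. On a compact convex family of measures the problem becomes the minimisation of a
convex integral functional on `L²(γ₁; ℓ²)` under one linear constraint, the value of the mean. By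
Hahn–Banach, for every `ε > 0` there is a multiplier `a` such that the optimiser minimises
`∫ (c + a)` up to `ε` without any constraint. Comparison with a measurable selection of pointwise
minimisers of `c + a` shows that `q_x` minimises `c(x, ·) + a` up to an error `h(x)` with
`∫ h dγ₁ ≤ ε`. When the inequality is summed over points `x^i` and competitors `m_i` with
`∑ m_i = ∑ q_{x^i}`, the multiplier cancels; for `ε = 2⁻ⁿ` the errors tend to `0` almost everywhere.

For the compactness, the average of `q` is tight, so almost every `q_x` lies in one of countably
many compact convex families of tight measures. Since `m_i ≤ ∑ q_{x^j}`, the competitors lie in a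
larger family of the same kind.
-/

namespace WOET

open Set Topology
open scoped BoundedContinuousFunction lp

section Duality

variable {E : Type*}

theorem nonempty_iInter_of_antitone_convex_isClosed_isBounded [NormedAddCommGroup E]
    [InnerProductSpace ℝ E] [CompleteSpace E] {A : ℕ → Set E} (hA : Antitone A)
    (hne : ∀ n, (A n).Nonempty) (hconv : ∀ n, Convex ℝ (A n)) (hclosed : ∀ n, IsClosed (A n))
    (hbdd : Bornology.IsBounded (A 0)) : (⋂ n, A n).Nonempty := by
  choose y hyA hy using fun n =>
    exists_norm_eq_iInf_of_complete_convex (hne n) (hclosed n).isComplete (hconv n) 0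
  have hyA' : ∀ {n m}, n ≤ m → y m ∈ A n := fun hnm => hA hnm (hyA _)
  have hdist : ∀ {n m}, n ≤ m → ‖y m - y n‖ ^ 2 ≤ ‖y m‖ ^ 2 - ‖y n‖ ^ 2 := fun {n m} hnm => by
    have hinner := (norm_eq_iInf_iff_real_inner_le_zero (hconv n) (hyA n)).1 (hy n) _ (hyA' hnm)
    rw [zero_sub, inner_neg_left, inner_sub_right, real_inner_self_eq_norm_sq,
      real_inner_comm] at hinner
    rw [norm_sub_sq_real]
    linarith
  have hmono : Monotone fun n => ‖y n‖ ^ 2 := fun n m hnm => by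
    linarith [hdist hnm, sq_nonneg ‖y m - y n‖]
  obtain ⟨R, hR⟩ := hbdd.exists_norm_le
  have hsup := tendsto_atTop_ciSup hmono ⟨R ^ 2, by
    rintro _ ⟨n, rfl⟩
    exact pow_le_pow_left₀ (norm_nonneg _) (hR _ (hyA' n.zero_le)) 2⟩
  set l : ℝ := ⨆ n, ‖y n‖ ^ 2
  have hcauchy : CauchySeq y := by
    refine cauchySeq_of_le_tendsto_0' (fun n => √(l - ‖y n‖ ^ 2)) (fun n m hnm => ?_) ?_
    · rw [dist_comm, dist_eq_norm]
      exact Real.le_sqrt_of_sq_le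
        ((hdist hnm).trans (sub_le_sub_right (hmono.ge_of_tendsto hsup m) _))
    · simpa using (hsup.const_sub l).sqrt
  obtain ⟨z, hz⟩ := cauchySeq_tendsto_of_complete hcauchy
  exact ⟨z, mem_iInter.2 fun n => (hclosed n).mem_of_tendsto hz
    ((eventually_ge_atTop n).mono fun m hm => hyA' hm)⟩

theorem exists_multiplier_of_local_lower_bound [AddCommGroup E] [Module ℝ E] [TopologicalSpace E]
    [IsTopologicalAddGroup E] [ContinuousSMul ℝ E] {S : Set (E × ℝ)} (hS : Convex ℝ S) {b : E}
    {r : ℝ} (hb : (b, r) ∈ S) {U : Set E} (hU : IsOpen U) (hUc : Convex ℝ U) (hbU : b ∈ U) {l : ℝ}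
    (hl : ∀ z ∈ S, z.1 ∈ U → l ≤ z.2) :
    ∃ a : E →L[ℝ] ℝ, ∀ z ∈ S, l ≤ z.2 + a (z.1 - b) := by
  have hdisj : Disjoint (U ×ˢ Iio l) S :=
    Set.disjoint_left.2 fun z hz hzS => (hl z hzS hz.1).not_gt hz.2
  obtain ⟨f, u, hfU, hfS⟩ := geometric_hahn_banach_open (hUc.prod (convex_Iio l))
    (hU.prod isOpen_Iio) hS hdisj
  set θ : ℝ := f (0, 1) with hθ
  let φ : E →L[ℝ] ℝ := f.comp (.inl ℝ E ℝ)
  have hf : ∀ z : E × ℝ, f z = φ z.1 + z.2 * θ := fun z => by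
    simp only [φ, hθ, ContinuousLinearMap.comp_apply, ContinuousLinearMap.inl_apply]
    rw [← smul_eq_mul, ← map_smul, ← map_add]
    simp
  have hbelow : ∀ s < l, φ b + s * θ < u := fun s hs => by
    simpa only [hf] using hfU (b, s) ⟨hbU, hs⟩
  have hθ_pos : 0 < θ := by
    have h₁ := hbelow (l - 1) (by linarith)
    have h₂ := hfS _ hb
    rw [hf] at h₂
    have h₃ := hl _ hb hbU
    dsimp only at h₂ h₃
    by_contra! hneg
    nlinarith
  have hlu : l ≤ (u - φ b) / θ :=
    le_of_forall_lt fun s hs => (lt_div_iff₀ hθ_pos).2 (by linarith [hbelow s hs])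
  refine ⟨θ⁻¹ • φ, fun z hz => ?_⟩
  calc l ≤ (u - φ b) / θ := hlu
    _ ≤ (φ z.1 + z.2 * θ - φ b) / θ := by
      gcongr
      exact (hfS z hz).trans_eq (hf z)
    _ = z.2 + (θ⁻¹ • φ) (z.1 - b) := by
      rw [smul_apply, map_sub, smul_eq_mul]
      field_simp
      ring

/-- The attainable pairs (constraint value, upper bound of the cost) of the problem of minimising
`J u` subject to a constraint on `m u`. -/
def attainable {H : Type*} (J : E → ℝ≥0∞) (m : E → H) : Set (H × ℝ) :=
  {z | ∃ u, m u = z.1 ∧ J u ≤ ENNReal.ofReal z.2 ∧ 0 ≤ z.2}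

theorem convex_attainable {H : Type*} [AddCommGroup E] [Module ℝ E] [AddCommGroup H] [Module ℝ H]
    {J : E → ℝ≥0∞} (hJ : ConvexOn ℝ≥0 univ J) (m : E →ₗ[ℝ] H) : Convex ℝ (attainable J m) := by
  rintro z ⟨u, hu, hJu, hz⟩ w ⟨v, hv, hJv, hw⟩ s t hs ht hst
  refine ⟨s • u + t • v, by simp [hu, hv], ?_, ?_⟩
  · lift s to ℝ≥0 using hs
    lift t to ℝ≥0 using ht
    calc J (s • u + t • v) ≤ s • J u + t • J v :=
          hJ.2 (mem_univ u) (mem_univ v) s.2 t.2 (by exact_mod_cast hst)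
      _ ≤ s • ENNReal.ofReal z.2 + t • ENNReal.ofReal w.2 := by gcongr
      _ = ENNReal.ofReal (s • z.2 + t • w.2) := by
        rw [ENNReal.ofReal_add (by positivity) (by positivity)]
        simp [ENNReal.smul_def, NNReal.smul_def, ENNReal.ofReal_mul]
  · simp only [Prod.snd_add, Prod.smul_snd, smul_eq_mul]
    positivity

variable [NormedAddCommGroup E] [InnerProductSpace ℝ E] [CompleteSpace E] {H : Type*}
  [NormedAddCommGroup H] [NormedSpace ℝ H] {J : E → ℝ≥0∞} {m : E →L[ℝ] H} {u₀ : E}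

theorem exists_ball_forall_lt_of_isMinOn_fiber (hJ : LowerSemicontinuous J)
    (hconv : ConvexOn ℝ≥0 univ J) (hbdd : Bornology.IsBounded {u | J u ≠ ∞})
    (hopt : ∀ u, m u = m u₀ → J u₀ ≤ J u) {r : ℝ≥0∞} (hr : r < J u₀) :
    ∃ δ > 0, ∀ u, m u ∈ Metric.ball (m u₀) δ → r < J u := by
  by_contra! hcon
  let A : ℕ → Set E := fun n => {u | J u ≤ r} ∩ m ⁻¹' Metric.closedBall (m u₀) (1 / (n + 1))
  obtain ⟨u, hu⟩ := nonempty_iInter_of_antitone_convex_isClosed_isBounded (A := A)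
    (fun n k hnk => inter_subset_inter_right _
      (preimage_mono (Metric.closedBall_subset_closedBall (Nat.one_div_le_one_div hnk))))
    (fun n => by
      obtain ⟨u, hu, hur⟩ := hcon (1 / (n + 1)) Nat.one_div_pos_of_nat
      exact ⟨u, hur, Metric.ball_subset_closedBall hu⟩)
    (fun n => .inter (fun u hu v hv s t hs ht hst => by
        lift s to ℝ≥0 using hs
        lift t to ℝ≥0 using ht
        exact (hconv.convex_le r ⟨mem_univ u, hu⟩ ⟨mem_univ v, hv⟩ s.2 t.2
          (by exact_mod_cast hst)).2)
      ((convex_closedBall _ _).linear_preimage m.toLinearMap))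
    (fun n => (hJ.isClosed_preimage r).inter (Metric.isClosed_closedBall.preimage m.continuous))
    (hbdd.subset fun u hu => (hu.1.trans_lt (hr.trans_le le_top)).ne)
  rw [mem_iInter] at hu
  refine ((hopt u ?_).trans (hu 0).1).not_gt hr
  have hlim := tendsto_one_div_add_atTop_nhds_zero_nat (𝕜 := ℝ)
  exact dist_le_zero.1 (ge_of_tendsto' hlim fun n => (hu n).2)

theorem exists_approx_multiplier (hJ : LowerSemicontinuous J) (hconv : ConvexOn ℝ≥0 univ J)
    (hbdd : Bornology.IsBounded {u | J u ≠ ∞}) (hfin : J u₀ ≠ ∞)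
    (hopt : ∀ u, m u = m u₀ → J u₀ ≤ J u) {ε : ℝ} (hε : 0 < ε) :
    ∃ a : H →L[ℝ] ℝ, ∀ u, J u ≠ ∞ → (J u₀).toReal ≤ (J u).toReal + a (m u - m u₀) + ε := by
  obtain ⟨δ, hδ, hball⟩ : ∃ δ > 0, ∀ u, m u ∈ Metric.ball (m u₀) δ →
      J u ≠ ∞ → (J u₀).toReal - ε ≤ (J u).toReal := by
    rcases eq_or_ne (J u₀) 0 with h₀ | h₀
    · exact ⟨1, one_pos, fun u _ _ => ENNReal.toReal_nonneg.trans' (by simp [h₀, hε.le])⟩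
    · have hlt : ENNReal.ofReal ((J u₀).toReal - ε) < J u₀ := by
        conv_rhs => rw [← ENNReal.ofReal_toReal hfin]
        exact (ENNReal.ofReal_lt_ofReal_iff (ENNReal.toReal_pos h₀ hfin)).2 (by linarith)
      obtain ⟨δ, hδ, h⟩ := exists_ball_forall_lt_of_isMinOn_fiber hJ hconv hbdd hopt hlt
      exact ⟨δ, hδ, fun u hu hfu => (ENNReal.ofReal_le_iff_le_toReal hfu).1 (h u hu).le⟩
  have hmem : ∀ u, J u ≠ ∞ → (m u, (J u).toReal) ∈ attainable J m := fun u hu =>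
    ⟨u, rfl, (ENNReal.ofReal_toReal hu).ge, ENNReal.toReal_nonneg⟩
  obtain ⟨a, ha⟩ := exists_multiplier_of_local_lower_bound (l := (J u₀).toReal - ε)
    (convex_attainable hconv m.toLinearMap) (hmem u₀ hfin) Metric.isOpen_ball (convex_ball _ _)
    (Metric.mem_ball_self hδ) fun z ⟨u, hu, hJu, hz⟩ hzδ =>
      (hball u (hu ▸ hzδ) (ne_top_of_le_ne_top ENNReal.ofReal_ne_top hJu)).trans
        (ENNReal.toReal_le_of_le_ofReal hz hJu)
  exact ⟨a, fun u hu => by linarith [ha _ (hmem u hu)]⟩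

end Duality

section Argmin

variable {X Y : Type*} [TopologicalSpace X] [TopologicalSpace Y]

theorem lowerSemicontinuous_biInf_of_isCompact {β : Type*} [CompleteLinearOrder β]
    [DenselyOrdered β] {G : X → Y → β} (hG : LowerSemicontinuous (Function.uncurry G)) {K : Set Y}
    (hK : IsCompact K) : LowerSemicontinuous fun x => ⨅ y ∈ K, G x y := by
  intro x a ha
  obtain ⟨b, hab, hb⟩ := exists_between ha
  have hsub : ({x} : Set X) ×ˢ K ⊆ Function.uncurry G ⁻¹' Ioi b := by
    rintro ⟨x', y⟩ ⟨rfl, hy⟩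
    exact hb.trans_le (iInf₂_le y hy)
  obtain ⟨U, V, hU, -, hxU, hKV, hUV⟩ :=
    generalized_tube_lemma isCompact_singleton hK (hG.isOpen_preimage b) hsub
  filter_upwards [hU.mem_nhds (hxU rfl)] with x' hx'
  exact hab.trans_le (le_iInf₂ fun y hy => (hUV (mk_mem_prod hx' (hKV hy))).le)

theorem exists_isLeast_argmin {Z : Set ℝ} [CompactSpace Z] [Nonempty Z] {G : Z → ℝ≥0∞}
    (hG : LowerSemicontinuous G) : ∃ t, IsLeast {t | ∀ u, G t ≤ G u} t := by
  obtain ⟨t, -, ht⟩ := (hG.lowerSemicontinuousOn univ).exists_isMinOn univ_nonempty isCompact_univ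
  have hclosed : IsClosed {t | ∀ u, G t ≤ G u} := by
    simp only [ofPred_forall]
    exact isClosed_iInter fun u => hG.isClosed_preimage (G u)
  exact hclosed.isCompact.exists_isLeast ⟨t, fun u => ht (mem_univ u)⟩

variable [MeasurableSpace X] [OpensMeasurableSpace X]

theorem measurable_of_isLeast_argmin {Z : Set ℝ} [CompactSpace Z] {G : X → Z → ℝ≥0∞}
    (hG : LowerSemicontinuous (Function.uncurry G)) {τ : X → Z}
    (hτ : ∀ x, IsLeast {t | ∀ u, G x t ≤ G x u} (τ x)) : Measurable τ := by
  suffices hcoe : Measurable fun x => (τ x : ℝ) from hcoe.subtype_mk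
  refine measurable_of_Iic fun a => ?_
  have hcompact : IsCompact {t : Z | (t : ℝ) ≤ a} :=
    (isClosed_le continuous_subtype_val continuous_const).isCompact
  by_cases hne : {t : Z | (t : ℝ) ≤ a}.Nonempty
  swap
  · convert MeasurableSet.empty
    exact eq_empty_of_forall_notMem fun x hx => hne ⟨τ x, hx⟩
  have hmeas : MeasurableSet
      {x | ⨅ t ∈ {t : Z | (t : ℝ) ≤ a}, G x t ≤ ⨅ t ∈ (univ : Set Z), G x t} :=
    measurableSet_le (lowerSemicontinuous_biInf_of_isCompact hG hcompact).measurable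
      (lowerSemicontinuous_biInf_of_isCompact hG isCompact_univ).measurable
  convert hmeas using 1
  ext x
  simp only [mem_preimage, mem_Iic, mem_ofPred_eq]
  refine ⟨fun hx => (iInf₂_le (τ x) hx).trans (le_iInf₂ fun u _ => (hτ x).1 u), fun hx => ?_⟩
  have hGx : LowerSemicontinuous (G x) := hG.comp (Continuous.prodMk_right x)
  obtain ⟨t, hta, ht⟩ := (hGx.lowerSemicontinuousOn _).exists_isMinOn hne hcompact
  have htmin : ∀ u, G x t ≤ G x u := fun u =>
    ((le_iInf₂ fun _ hv => ht hv).trans hx).trans (iInf₂_le u (mem_univ u))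
  exact (Subtype.coe_le_coe.2 ((hτ x).2 htmin)).trans hta

/- Parametrise `K` by the Cantor set: as a compact subset of the line, it has least minimisers. -/
theorem exists_measurable_argmin [TopologicalSpace.MetrizableSpace Y] [MeasurableSpace Y]
    [BorelSpace Y] {G : X → Y → ℝ≥0∞} (hG : LowerSemicontinuous (Function.uncurry G)) {K : Set Y}
    (hK : IsCompact K) (hne : K.Nonempty) :
    ∃ s : X → Y, Measurable s ∧ ∀ x, s x ∈ K ∧ ∀ y ∈ K, G x (s x) ≤ G x y := by
  let := TopologicalSpace.metrizableSpaceMetric Y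
  have : CompactSpace K := isCompact_iff_compactSpace.1 hK
  have : Nonempty K := hne.to_subtype
  have : CompactSpace cantorSet := isCompact_iff_compactSpace.1 isCompact_cantorSet
  have : Nonempty cantorSet := ⟨cantorSetHomeomorphNatToBool.symm default⟩
  obtain ⟨f₀, hf₀, hf₀_surj⟩ := exists_nat_bool_continuous_surjective_of_compact K
  let f : cantorSet → K := f₀ ∘ cantorSetHomeomorphNatToBool
  have hf : Continuous f := hf₀.comp cantorSetHomeomorphNatToBool.continuous
  have hf_surj : Function.Surjective f :=
    hf₀_surj.comp cantorSetHomeomorphNatToBool.surjective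
  have hGf : LowerSemicontinuous (Function.uncurry fun x t => G x (f t)) :=
    hG.comp (g := fun z : X × cantorSet => (z.1, (f z.2 : Y))) (by fun_prop)
  choose τ hτ using fun x =>
    exists_isLeast_argmin (G := fun t => G x (f t)) (hGf.comp (Continuous.prodMk_right x))
  refine ⟨fun x => f (τ x), (hf.measurable.comp (measurable_of_isLeast_argmin hGf hτ)).subtype_val,
    fun x => ⟨(f (τ x)).2, fun y hy => ?_⟩⟩
  obtain ⟨t, ht⟩ := hf_surj ⟨y, hy⟩
  simpa only [ht] using (hτ x).1 t

end Argmin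

section IntegralFunctional

theorem measurable_comp_graph {X Y Z : Type*} [MeasurableSpace X] [MeasurableSpace Y]
    [MeasurableSpace Z] {c : X → Y → Z} (hc : Measurable (Function.uncurry c)) {g : X → Y}
    (hg : Measurable g) : Measurable fun x => c x (g x) :=
  hc.comp (measurable_id.prodMk hg)

variable {X : Type*} [MeasurableSpace X] {μ : Measure X} {H : Type*} [NormedAddCommGroup H]
  {p : ℝ≥0∞} {c : X → H → ℝ≥0∞}

/-- The integral functional `u ↦ ∫ c(x, u(x)) dμ(x)` on `Lᵖ(μ; H)`. -/
noncomputable def integralFunctional (p : ℝ≥0∞) (μ : Measure X) (c : X → H → ℝ≥0∞)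
    (u : Lp H p μ) : ℝ≥0∞ :=
  ∫⁻ x, c x (u x) ∂μ

theorem integralFunctional_toLp {g : X → H} (hg : MemLp g p μ) :
    integralFunctional p μ c (hg.toLp g) = ∫⁻ x, c x (g x) ∂μ :=
  lintegral_congr_ae (by filter_upwards [hg.coeFn_toLp] with x hx using by rw [hx])

/-- The integral of square integrable functions on a finite measure space, as a continuous linear
map. -/
noncomputable def integralCLM (μ : Measure X) [IsFiniteMeasure μ] (H : Type*) [NormedAddCommGroup H]
    [NormedSpace ℝ H] [CompleteSpace H] : Lp H 2 μ →L[ℝ] H :=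
  (ContinuousLinearMap.lsmul ℝ ℝ).lpPairing μ 2 2 (Lp.const 2 μ 1)

theorem integralCLM_apply [NormedSpace ℝ H] [CompleteSpace H] [IsFiniteMeasure μ] (u : Lp H 2 μ) :
    integralCLM μ H u = ∫ x, u x ∂μ := by
  rw [integralCLM, ContinuousLinearMap.lpPairing_eq_integral]
  refine integral_congr_ae ?_
  filter_upwards [Lp.coeFn_const (p := 2) (μ := μ) (1 : ℝ)] with x hx
  rw [hx, Function.const_apply, ContinuousLinearMap.lsmul_apply, one_smul]

variable [MeasurableSpace H] [BorelSpace H]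

theorem measurable_integrand (hc : Measurable (Function.uncurry c)) (u : Lp H p μ) :
    Measurable fun x => c x (u x) :=
  measurable_comp_graph hc (Lp.stronglyMeasurable u).measurable

theorem lowerSemicontinuous_integralFunctional [Fact (1 ≤ p)]
    (hc : Measurable (Function.uncurry c)) (hlsc : ∀ x, LowerSemicontinuous (c x)) :
    LowerSemicontinuous (integralFunctional p μ c) := by
  refine lowerSemicontinuous_iff_isClosed_preimage.2 fun r =>
    IsSeqClosed.isClosed fun u v hur huv => ?_
  obtain ⟨φ, -, hφ⟩ := (tendstoInMeasure_of_tendsto_Lp huv).exists_seq_tendsto_ae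
  calc ∫⁻ x, c x (v x) ∂μ
      ≤ ∫⁻ x, liminf (fun n => c x (u (φ n) x)) atTop ∂μ := by
        refine lintegral_mono_ae ?_
        filter_upwards [hφ] with x hx
        exact ((hlsc x).le_liminf (v x)).trans hx.liminf_le_liminf_comp
    _ ≤ liminf (fun n => ∫⁻ x, c x (u (φ n) x) ∂μ) atTop :=
        lintegral_liminf_le fun n => measurable_integrand hc _
    _ ≤ r := liminf_le_of_le (by isBoundedDefault) fun b hb =>
        let ⟨n, hn⟩ := hb.exists
        hn.trans (hur (φ n))

theorem ae_mem_of_integralFunctional_ne_top (hc : Measurable (Function.uncurry c)) {K : Set H}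
    (hcK : ∀ x y, c x y ≠ ∞ → y ∈ K) {u : Lp H p μ} (hu : integralFunctional p μ c u ≠ ∞) :
    ∀ᵐ x ∂μ, u x ∈ K := by
  filter_upwards [ae_lt_top (measurable_integrand hc u) hu] with x hx using hcK x _ hx.ne

theorem isBounded_integralFunctional_ne_top [IsFiniteMeasure μ] [Fact (1 ≤ p)]
    (hc : Measurable (Function.uncurry c)) {K : Set H} (hK : Bornology.IsBounded K)
    (hcK : ∀ x y, c x y ≠ ∞ → y ∈ K) :
    Bornology.IsBounded {u : Lp H p μ | integralFunctional p μ c u ≠ ∞} := by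
  obtain ⟨R, hR⟩ := hK.exists_norm_le
  refine isBounded_iff_forall_norm_le.2 ⟨_, fun u hu => Lp.norm_le_of_ae_bound (C := max R 0)
    (le_max_right _ _) ?_⟩
  filter_upwards [ae_mem_of_integralFunctional_ne_top hc hcK hu] with x hx
  exact (hR _ hx).trans (le_max_left _ _)

variable [NormedSpace ℝ H]

theorem convexOn_integralFunctional (hc : Measurable (Function.uncurry c))
    (hconv : ∀ x, ConvexOn ℝ≥0 univ (c x)) :
    ConvexOn ℝ≥0 univ (integralFunctional p μ c) := by
  refine ⟨convex_univ, fun u _ v _ s t hs ht hst => ?_⟩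
  calc ∫⁻ x, c x ((s • u + t • v : Lp H p μ) x) ∂μ
      ≤ ∫⁻ x, (s • c x (u x) + t • c x (v x)) ∂μ := by
        refine lintegral_mono_ae ?_
        filter_upwards [Lp.coeFn_add (s • u) (t • v), Lp.coeFn_smul (s : ℝ) u,
          Lp.coeFn_smul (t : ℝ) v] with x hadd hu hv
        have hcomb : (s • u + t • v : Lp H p μ) x = s • u x + t • v x := by
          rw [hadd, Pi.add_apply]
          exact congrArg₂ (· + ·) hu hv
        rw [hcomb]
        exact (hconv x).2 (mem_univ _) (mem_univ _) hs ht hst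
    _ = s • ∫⁻ x, c x (u x) ∂μ + t • ∫⁻ x, c x (v x) ∂μ := by
        simp only [ENNReal.smul_def, smul_eq_mul]
        rw [lintegral_add_left ((measurable_integrand hc u).const_mul _),
          lintegral_const_mul _ (measurable_integrand hc u),
          lintegral_const_mul _ (measurable_integrand hc v)]

end IntegralFunctional

section Tilt

variable {X : Type*} {H : Type*} [NormedAddCommGroup H] [NormedSpace ℝ H] {c : X → H → ℝ≥0∞}
  {a : H →L[ℝ] ℝ} {M : ℝ}

/-- The cost `c` with the multiplier `a` added to it. The constant `M` serves to make `a + M`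
non-negative on the relevant set, as `ENNReal.ofReal` truncates negative values. -/
noncomputable def tilt (c : X → H → ℝ≥0∞) (a : H →L[ℝ] ℝ) (M : ℝ) (x : X) (y : H) : ℝ≥0∞ :=
  c x y + ENNReal.ofReal (a y + M)

theorem lintegral_tilt [MeasurableSpace X] {μ : Measure X} [IsFiniteMeasure μ] {p : X → H}
    (hcp : Measurable fun x => c x (p x)) (hp : Integrable p μ) (hM : ∀ x, 0 ≤ a (p x) + M) :
    ∫⁻ x, tilt c a M x (p x) ∂μ
      = ∫⁻ x, c x (p x) ∂μ + ENNReal.ofReal (∫ x, (a (p x) + M) ∂μ) := by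
  have hint : Integrable (fun x => a (p x) + M) μ := (a.integrable_comp hp).add (integrable_const M)
  rw [ofReal_integral_eq_lintegral_ofReal hint (ae_of_all _ hM), ← lintegral_add_left hcp]
  rfl

theorem sum_le_sum_add_sum_of_tilt_le {ι : Type*} {s : Finset ι} {x : ι → X} {y z : ι → H}
    {h : ι → ℝ≥0∞} (hy : ∀ i ∈ s, 0 ≤ a (y i) + M) (hz : ∀ i ∈ s, 0 ≤ a (z i) + M)
    (hle : ∀ i ∈ s, tilt c a M (x i) (y i) ≤ tilt c a M (x i) (z i) + h i)
    (hsum : ∑ i ∈ s, z i = ∑ i ∈ s, y i) :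
    ∑ i ∈ s, c (x i) (y i) ≤ ∑ i ∈ s, c (x i) (z i) + ∑ i ∈ s, h i := by
  have hmult : ∑ i ∈ s, ENNReal.ofReal (a (y i) + M) = ∑ i ∈ s, ENNReal.ofReal (a (z i) + M) := by
    rw [← ENNReal.ofReal_sum_of_nonneg hy, ← ENNReal.ofReal_sum_of_nonneg hz,
      Finset.sum_add_distrib, Finset.sum_add_distrib, ← map_sum, ← map_sum, hsum]
  have htilt := Finset.sum_le_sum hle
  simp only [tilt, Finset.sum_add_distrib] at htilt
  rw [hmult, add_right_comm] at htilt
  exact (ENNReal.add_le_add_iff_right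
    (ENNReal.sum_ne_top.2 fun _ _ => ENNReal.ofReal_ne_top)).1 htilt

end Tilt

section MeanMinimizer

variable {X : Type*} [MeasurableSpace X] {μ : Measure X} {H : Type*} [MeasurableSpace H] {K : Set H}
  {g : X → H}

theorem exists_measurable_ae_eq_mem (hK : MeasurableSet K) (hg : Measurable g)
    (hgK : ∀ x, g x ∈ K) {u : X → H} (hu : Measurable u) (huK : ∀ᵐ x ∂μ, u x ∈ K) :
    ∃ p : X → H, Measurable p ∧ (∀ x, p x ∈ K) ∧ p =ᵐ[μ] u := by
  classical
  refine ⟨(u ⁻¹' K).piecewise u g, hu.piecewise (hu hK) hg, fun x => ?_, ?_⟩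
  · by_cases hx : u x ∈ K
    · rwa [piecewise_eq_of_mem (u ⁻¹' K) _ _ hx]
    · rw [piecewise_eq_of_notMem (u ⁻¹' K) _ _ hx]
      exact hgK x
  · filter_upwards [huK] with x hx using piecewise_eq_of_mem _ _ _ hx

variable [NormedAddCommGroup H]

theorem memLp_of_forall_mem [BorelSpace H] [SecondCountableTopology H] [IsFiniteMeasure μ]
    (hK : Bornology.IsBounded K) (hg : Measurable g) (hgK : ∀ x, g x ∈ K) (p : ℝ≥0∞) :
    MemLp g p μ := by
  obtain ⟨R, hR⟩ := hK.exists_norm_le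
  exact .of_bound hg.aestronglyMeasurable R (ae_of_all _ fun x => hR _ (hgK x))

/-- `g` has finite cost `∫ c(x, g(x)) dμ(x)`, which is least among the measurable `K`-valued maps
with the same integral. -/
structure IsMeanMinimizer [NormedSpace ℝ H] (μ : Measure X) (c : X → H → ℝ≥0∞) (K : Set H)
    (g : X → H) : Prop where
  measurable : Measurable g
  mem : ∀ x, g x ∈ K
  ne_top : ∫⁻ x, c x (g x) ∂μ ≠ ∞
  le : ∀ p : X → H, Measurable p → (∀ x, p x ∈ K) → ∫ x, p x ∂μ = ∫ x, g x ∂μ →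
    ∫⁻ x, c x (g x) ∂μ ≤ ∫⁻ x, c x (p x) ∂μ

variable [InnerProductSpace ℝ H] [CompleteSpace H] [BorelSpace H] [SecondCountableTopology H]
  [IsFiniteMeasure μ] {c : X → H → ℝ≥0∞} {ε : ℝ}

theorem IsMeanMinimizer.exists_approx_multiplier (hg : IsMeanMinimizer μ c K g)
    (hc : Measurable (Function.uncurry c)) (hlsc : ∀ x, LowerSemicontinuous (c x))
    (hconv : ∀ x, ConvexOn ℝ≥0 univ (c x)) (hK : MeasurableSet K) (hKb : Bornology.IsBounded K)
    (hcK : ∀ x y, c x y ≠ ∞ → y ∈ K) (hε : 0 < ε) :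
    ∃ a : H →L[ℝ] ℝ, ∀ p : X → H, Measurable p → (∀ x, p x ∈ K) → ∫⁻ x, c x (p x) ∂μ ≠ ∞ →
      (∫⁻ x, c x (g x) ∂μ).toReal
        ≤ (∫⁻ x, c x (p x) ∂μ).toReal + a (∫ x, p x ∂μ - ∫ x, g x ∂μ) + ε := by
  have hLp : ∀ {p : X → H}, Measurable p → (∀ x, p x ∈ K) → MemLp p 2 μ := fun hp hpK =>
    memLp_of_forall_mem hKb hp hpK 2
  have hmean : ∀ {p : X → H} (hp : MemLp p 2 μ), integralCLM μ H (hp.toLp p) = ∫ x, p x ∂μ :=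
    fun hp => (integralCLM_apply _).trans (integral_congr_ae hp.coeFn_toLp)
  obtain ⟨a, ha⟩ := WOET.exists_approx_multiplier (u₀ := (hLp hg.measurable hg.mem).toLp g)
    (m := integralCLM μ H) (lowerSemicontinuous_integralFunctional hc hlsc)
    (convexOn_integralFunctional hc hconv) (isBounded_integralFunctional_ne_top hc hKb hcK)
    (by rw [integralFunctional_toLp]; exact hg.ne_top) (fun u hu => by
      rcases eq_or_ne (integralFunctional 2 μ c u) ∞ with htop | hne
      · exact htop ▸ le_top
      obtain ⟨p, hp, hpK, hpu⟩ := exists_measurable_ae_eq_mem hK hg.measurable hg.mem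
        (Lp.stronglyMeasurable u).measurable (ae_mem_of_integralFunctional_ne_top hc hcK hne)
      obtain rfl : u = (hLp hp hpK).toLp p :=
        Lp.ext (hpu.symm.trans (hLp hp hpK).coeFn_toLp.symm)
      simp only [hmean, integralFunctional_toLp] at hu ⊢
      exact hg.le p hp hpK hu) hε
  refine ⟨a, fun p hp hpK hfin => ?_⟩
  simpa only [hmean, integralFunctional_toLp] using
    ha ((hLp hp hpK).toLp p) (by rwa [integralFunctional_toLp])

theorem IsMeanMinimizer.exists_tilt_almost_minimal (hg : IsMeanMinimizer μ c K g)
    (hc : Measurable (Function.uncurry c)) (hlsc : ∀ x, LowerSemicontinuous (c x))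
    (hconv : ∀ x, ConvexOn ℝ≥0 univ (c x)) (hK : IsCompact K)
    (hcK : ∀ x y, c x y ≠ ∞ → y ∈ K) (hε : 0 < ε) :
    ∃ (a : H →L[ℝ] ℝ) (M : ℝ), (∀ y ∈ K, 0 ≤ a y + M) ∧ ∫⁻ x, tilt c a M x (g x) ∂μ ≠ ∞ ∧
      ∀ p : X → H, Measurable p → (∀ x, p x ∈ K) →
        ∫⁻ x, tilt c a M x (g x) ∂μ ≤ ∫⁻ x, tilt c a M x (p x) ∂μ + ENNReal.ofReal ε := by
  obtain ⟨a, ha⟩ := hg.exists_approx_multiplier hc hlsc hconv hK.measurableSet hK.isBounded hcK hε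
  obtain ⟨M, hM⟩ := hK.exists_bound_of_continuousOn a.continuous.continuousOn
  have hnonneg : ∀ y ∈ K, 0 ≤ a y + M := fun y hy => by linarith [(abs_le.1 (hM y hy)).1]
  have hint : ∀ {p : X → H}, Measurable p → (∀ x, p x ∈ K) → Integrable p μ := fun hp hpK =>
    (memLp_of_forall_mem hK.isBounded hp hpK 1).integrable le_rfl
  have htilt : ∀ {p : X → H}, Measurable p → (∀ x, p x ∈ K) → ∫⁻ x, tilt c a M x (p x) ∂μ
      = ∫⁻ x, c x (p x) ∂μ + ENNReal.ofReal (∫ x, (a (p x) + M) ∂μ) := fun hp hpK =>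
    lintegral_tilt (measurable_comp_graph hc hp) (hint hp hpK) fun x => hnonneg _ (hpK x)
  have hmult : ∀ {p : X → H}, Measurable p → (∀ x, p x ∈ K) →
      ∫ x, (a (p x) + M) ∂μ = a (∫ x, p x ∂μ) + M * μ.real univ := fun hp hpK => by
    rw [integral_add (a.integrable_comp (hint hp hpK)) (integrable_const M),
      a.integral_comp_comm (hint hp hpK), integral_const, smul_eq_mul, mul_comm M]
  refine ⟨a, M, hnonneg, ?_, fun p hp hpK => ?_⟩
  · rw [htilt hg.measurable hg.mem]
    exact ENNReal.add_ne_top.2 ⟨hg.ne_top, ENNReal.ofReal_ne_top⟩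
  rcases eq_or_ne (∫⁻ x, c x (p x) ∂μ) ∞ with htop | hfin
  · simp [htilt hp hpK, htop]
  have hB : ∀ {p : X → H}, (∀ x, p x ∈ K) → 0 ≤ ∫ x, (a (p x) + M) ∂μ := fun hpK =>
    integral_nonneg fun x => hnonneg _ (hpK x)
  rw [htilt hg.measurable hg.mem, htilt hp hpK, ← ENNReal.ofReal_toReal hg.ne_top,
    ← ENNReal.ofReal_toReal hfin, ← ENNReal.ofReal_add ENNReal.toReal_nonneg (hB hg.mem),
    ← ENNReal.ofReal_add ENNReal.toReal_nonneg (hB hpK),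
    ← ENNReal.ofReal_add (add_nonneg ENNReal.toReal_nonneg (hB hpK)) hε.le]
  refine ENNReal.ofReal_le_ofReal ?_
  rw [hmult hg.measurable hg.mem, hmult hp hpK]
  linarith [ha p hp hpK hfin, a.map_sub (∫ x, p x ∂μ) (∫ x, g x ∂μ)]

variable [TopologicalSpace X] [OpensMeasurableSpace X]

theorem IsMeanMinimizer.exists_pointwise_certificate (hg : IsMeanMinimizer μ c K g)
    (hc : LowerSemicontinuous (Function.uncurry c)) (hconv : ∀ x, ConvexOn ℝ≥0 univ (c x))
    (hK : IsCompact K) (hcK : ∀ x y, c x y ≠ ∞ → y ∈ K) (hε : 0 < ε) :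
    ∃ (a : H →L[ℝ] ℝ) (M : ℝ) (h : X → ℝ≥0∞), Measurable h ∧ ∫⁻ x, h x ∂μ ≤ ENNReal.ofReal ε ∧
      (∀ y ∈ K, 0 ≤ a y + M) ∧
      ∀ x, ∀ y ∈ K, tilt c a M x (g x) ≤ tilt c a M x y + h x := by
  rcases isEmpty_or_nonempty X with hX | ⟨⟨x₀⟩⟩
  · exact ⟨0, 0, 0, measurable_zero, by simp, by simp, fun x => isEmptyElim x⟩
  obtain ⟨a, M, hM, hfin, hmin⟩ := hg.exists_tilt_almost_minimal hc.measurable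
    (fun x => hc.comp (Continuous.prodMk_right x)) hconv hK hcK hε
  have htilt : LowerSemicontinuous (Function.uncurry (tilt c a M)) :=
    hc.add (ENNReal.continuous_ofReal.comp
      ((a.continuous.comp continuous_snd).add continuous_const)).lowerSemicontinuous
  obtain ⟨s, hs, hsmin⟩ := exists_measurable_argmin htilt hK ⟨g x₀, hg.mem x₀⟩
  have htilt_meas : ∀ {p : X → H}, Measurable p → Measurable fun x => tilt c a M x (p x) :=
    fun hp => measurable_comp_graph htilt.measurable hp
  have hle : ∀ x, tilt c a M x (s x) ≤ tilt c a M x (g x) := fun x => (hsmin x).2 _ (hg.mem x)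
  refine ⟨a, M, fun x => tilt c a M x (g x) - tilt c a M x (s x),
    (htilt_meas hg.measurable).sub (htilt_meas hs), ?_, hM, fun x y hy => ?_⟩
  · rw [lintegral_sub (htilt_meas hs) (ne_top_of_le_ne_top hfin (lintegral_mono hle))
      (ae_of_all _ hle), tsub_le_iff_left]
    exact hmin s hs fun x => (hsmin x).1
  · calc tilt c a M x (g x)
        ≤ tilt c a M x (s x) + (tilt c a M x (g x) - tilt c a M x (s x)) := le_add_tsub
      _ ≤ tilt c a M x y + (tilt c a M x (g x) - tilt c a M x (s x)) := by
        gcongr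
        exact (hsmin x).2 y hy

theorem IsMeanMinimizer.exists_monotone_set (hg : IsMeanMinimizer μ c K g)
    (hc : LowerSemicontinuous (Function.uncurry c)) (hconv : ∀ x, ConvexOn ℝ≥0 univ (c x))
    (hK : IsCompact K) (hcK : ∀ x y, c x y ≠ ∞ → y ∈ K) :
    ∃ Γ : Set X, MeasurableSet Γ ∧ μ Γᶜ = 0 ∧ ∀ (N : ℕ) (x : Fin N → X), (∀ i, x i ∈ Γ) →
      ∀ m : Fin N → H, (∀ i, m i ∈ K) → ∑ i, m i = ∑ i, g (x i) →
        ∑ i, c (x i) (g (x i)) ≤ ∑ i, c (x i) (m i) := by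
  have hpos : ∀ n : ℕ, (0 : ℝ) < (1 / 2) ^ n := fun n => by positivity
  choose a M h hh hint hM hcert using fun n =>
    hg.exists_pointwise_certificate hc hconv hK hcK (hpos n)
  have hlim : ∀ᵐ x ∂μ, Tendsto (fun n => h n x) atTop (𝓝 0) := by
    have hsum : ∫⁻ x, ∑' n, h n x ∂μ ≠ ∞ := by
      rw [lintegral_tsum fun n => (hh n).aemeasurable]
      refine ne_top_of_le_ne_top ?_ (ENNReal.tsum_le_tsum hint)
      rw [← ENNReal.ofReal_tsum_of_nonneg (fun n => (hpos n).le) summable_geometric_two]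
      exact ENNReal.ofReal_ne_top
    filter_upwards [ae_lt_top (.tsum hh) hsum] with x hx
    exact ENNReal.tendsto_atTop_zero_of_tsum_ne_top hx.ne
  obtain ⟨Z, hZ, hZ_meas, hZ_null⟩ := exists_measurable_superset_of_null (ae_iff.1 hlim)
  refine ⟨Zᶜ, hZ_meas.compl, by rwa [compl_compl], fun N x hx m hm hsum => ?_⟩
  have hle : ∀ n, ∑ i, c (x i) (g (x i)) ≤ ∑ i, c (x i) (m i) + ∑ i, h n (x i) := fun n =>
    sum_le_sum_add_sum_of_tilt_le (fun i _ => hM n _ (hg.mem _)) (fun i _ => hM n _ (hm i))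
      (fun i _ => hcert n _ _ (hm i)) hsum
  have herr : Tendsto (fun n => ∑ i, h n (x i)) atTop (𝓝 0) := by
    simpa using tendsto_finsetSum Finset.univ fun i _ =>
      not_not.1 fun hi : ¬ Tendsto (fun n => h n (x i)) atTop (𝓝 0) => hx i (hZ hi)
  simpa using ge_of_tendsto' (tendsto_const_nhds.add herr) hle

end MeanMinimizer

section Separating

variable {Y : Type*} [TopologicalSpace Y]

theorem exists_countable_isPiSystem_isClosed [SecondCountableTopology Y] :
    ∃ S : Set (Set Y), S.Countable ∧ univ ∈ S ∧ (∀ s ∈ S, IsClosed s) ∧ IsPiSystem S ∧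
      borel Y = MeasurableSpace.generateFrom S := by
  let b := TopologicalSpace.countableBasis Y
  let S : Set (Set Y) := (fun t : Set (Set Y) => (⋃₀ t)ᶜ) '' {t | t.Finite ∧ t ⊆ b}
  have hclosed : ∀ s ∈ S, IsClosed s := by
    rintro _ ⟨t, ⟨-, ht⟩, rfl⟩
    exact (isOpen_sUnion fun u hu =>
      TopologicalSpace.isOpen_of_mem_countableBasis (ht hu)).isClosed_compl
  have hcount : S.Countable := (countable_ofPred_finite_subset
    (TopologicalSpace.countable_countableBasis Y)).image _
  have huniv : univ ∈ S :=
    ⟨∅, ⟨finite_empty, empty_subset _⟩, by simp only [sUnion_empty, compl_empty]⟩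
  refine ⟨S, hcount, huniv, hclosed, ?_, le_antisymm ?_ ?_⟩
  · rintro _ ⟨t, ⟨htf, ht⟩, rfl⟩ _ ⟨u, ⟨huf, hu⟩, rfl⟩ -
    refine ⟨t ∪ u, ⟨htf.union huf, union_subset ht hu⟩, ?_⟩
    simp only [sUnion_union, compl_union]
  · rw [(TopologicalSpace.isBasis_countableBasis Y).borel_eq_generateFrom]
    refine MeasurableSpace.generateFrom_le fun u hu => ?_
    rw [← compl_compl u]
    have huS : uᶜ ∈ S :=
      ⟨{u}, ⟨finite_singleton u, singleton_subset_iff.2 hu⟩, by simp only [sUnion_singleton]⟩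
    exact (MeasurableSpace.measurableSet_generateFrom huS).compl
  · rw [borel_eq_generateFrom_isClosed]
    exact MeasurableSpace.generateFrom_mono hclosed

theorem exists_seq_boundedContinuousFunction_separating [SecondCountableTopology Y]
    [MeasurableSpace Y] [BorelSpace Y] [HasOuterApproxClosed Y] :
    ∃ φ : ℕ → Y →ᵇ ℝ≥0, (∀ n y, φ n y ≤ 1) ∧
      ∀ ν₁ ν₂ : Measure Y, IsFiniteMeasure ν₁ → IsFiniteMeasure ν₂ →
        (∀ n, ∫⁻ y, φ n y ∂ν₁ = ∫⁻ y, φ n y ∂ν₂) → ν₁ = ν₂ := by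
  obtain ⟨S, hcount, huniv, hclosed, hpi, hgen⟩ := exists_countable_isPiSystem_isClosed (Y := Y)
  obtain ⟨F, hF⟩ := hcount.exists_eq_range ⟨univ, huniv⟩
  have hFclosed : ∀ i, IsClosed (F i) := fun i => hclosed _ (hF ▸ mem_range_self i)
  refine ⟨fun n => (hFclosed n.unpair.1).apprSeq n.unpair.2,
    fun n y => HasOuterApproxClosed.apprSeq_apply_le_one _ _ _, fun ν₁ ν₂ _ _ h => ?_⟩
  have heq : ∀ s ∈ S, ν₁ s = ν₂ s := by
    rw [hF]
    rintro _ ⟨i, rfl⟩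
    refine tendsto_nhds_unique
      (HasOuterApproxClosed.tendsto_lintegral_apprSeq (hFclosed i) ν₁) ?_
    convert HasOuterApproxClosed.tendsto_lintegral_apprSeq (hFclosed i) ν₂ using 2 with n
    simpa only [Nat.unpair_pair] using h (Nat.pair i n)
  exact ext_of_generate_finite S (BorelSpace.measurable_eq.trans hgen) hpi heq (heq univ huniv)

theorem measurable_toMeasure_borel [MeasurableSpace Y] [BorelSpace Y] [HasOuterApproxClosed Y] :
    Measurable[borel (ProbabilityMeasure Y)] fun p : ProbabilityMeasure Y => (p : Measure Y) := by
  let _ : MeasurableSpace (ProbabilityMeasure Y) := borel _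
  have : BorelSpace (ProbabilityMeasure Y) := ⟨rfl⟩
  refine Measurable.measure_of_isPiSystem_of_isProbabilityMeasure
    (BorelSpace.measurable_eq.trans borel_eq_generateFrom_isClosed)
    (fun s hs t ht _ => hs.inter ht) fun s hs => ?_
  refine measurable_of_tendsto_metrizable (fun n =>
    (ProbabilityMeasure.continuous_lintegral_boundedContinuousFunction (hs.apprSeq n)).measurable)
    (tendsto_pi_nhds.2 fun p => HasOuterApproxClosed.tendsto_lintegral_apprSeq hs p)

end Separating

section FeatureMap

theorem continuous_lp_of_coord {Z ι : Type*} [TopologicalSpace Z] {E : ι → Type*}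
    [∀ i, NormedAddCommGroup (E i)] [∀ i, CompleteSpace (E i)] {p : ℝ≥0∞}
    [Fact (1 ≤ p)] (hp : p ≠ ∞) {u : Z → lp E p} {b : ι → ℝ} (hb : Summable b)
    (hcont : ∀ i, Continuous fun z => u z i) (hub : ∀ i z, ‖u z i‖ ≤ b i) : Continuous u := by
  classical
  have hseries : u = fun z => ∑' i, lp.single p i (u z i) :=
    funext fun z => (lp.hasSum_single hp (u z)).tsum_eq.symm
  rw [hseries]
  refine continuous_tsum (fun i => (lp.singleContinuousAddMonoidHom E p i).continuous.comp
    (hcont i)) hb fun i z => ?_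
  exact (lp.norm_single (zero_lt_one.trans_le Fact.out) i (u z i)).trans_le (hub i z)

instance secondCountableTopology_l2 : SecondCountableTopology ℓ²(ℕ, ℝ) := by
  have b : HilbertBasis ℕ ℝ ℓ²(ℕ, ℝ) := ⟨LinearIsometryEquiv.refl ℝ _⟩
  have hsep := (countable_range b).isSeparable.span (R := ℝ) |>.closure
  rw [← Submodule.topologicalClosure_coe, b.dense_span, Submodule.top_coe,
    TopologicalSpace.isSeparable_univ_iff] at hsep
  exact UniformSpace.secondCountable_of_separable _

variable {Y H : Type*} [TopologicalSpace Y]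

theorem norm_half_pow_mul_le {φ : ℕ → Y →ᵇ ℝ≥0} (hφ : ∀ n y, φ n y ≤ 1) (n : ℕ) (y : Y) :
    ‖(1 / 2 : ℝ) ^ n * φ n y‖ ≤ (1 / 2) ^ n := by
  rw [Real.norm_of_nonneg (by positivity)]
  exact mul_le_of_le_one_right (by positivity) (hφ n y)

theorem memℓp_half_pow_mul {φ : ℕ → Y →ᵇ ℝ≥0} (hφ : ∀ n y, φ n y ≤ 1) (y : Y) :
    Memℓp (fun n => (1 / 2 : ℝ) ^ n * φ n y) 2 := by
  have h : Memℓp (fun n => (1 / 2 : ℝ) ^ n * φ n y) 1 := memℓp_gen <| by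
    simpa only [ENNReal.toReal_one, Real.rpow_one] using
      summable_geometric_two.of_nonneg_of_le (fun _ => norm_nonneg _)
        fun n => norm_half_pow_mul_le hφ n y
  exact h.of_exponent_ge one_le_two

/-- The feature map `y ↦ (2⁻ⁿ φ n y)ₙ`, which is characteristic if the functions `φ n` separate the
finite measures. -/
noncomputable def l2Features (φ : ℕ → Y →ᵇ ℝ≥0) (hφ : ∀ n y, φ n y ≤ 1) : Y →ᵇ ℓ²(ℕ, ℝ) :=
  BoundedContinuousFunction.ofNormedAddCommGroup (fun y => ⟨_, memℓp_half_pow_mul hφ y⟩)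
    (continuous_lp_of_coord ENNReal.ofNat_ne_top summable_geometric_two
      (fun n => continuous_const.mul (NNReal.continuous_coe.comp (φ n).continuous))
      (norm_half_pow_mul_le hφ)) 2 fun y =>
    (lp.hasSum_single (p := 2) ENNReal.ofNat_ne_top _).norm_le_of_bounded hasSum_geometric_two
      fun n => (lp.norm_single two_pos n _).trans_le (norm_half_pow_mul_le hφ n y)

variable [MeasurableSpace Y] [OpensMeasurableSpace Y] [NormedAddCommGroup H]
  [NormedSpace ℝ H]

/-- The mean of a feature map `f` under a probability measure. -/
noncomputable def featureMean (f : Y →ᵇ H) (p : ProbabilityMeasure Y) : H :=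
  ∫ y, f y ∂(p : Measure Y)

/-- Characteristic feature maps: finite measures are determined by the integral of `f`, and the
mean embedding of the probability measures is weakly continuous. -/
structure IsCharacteristic (f : Y →ᵇ H) : Prop where
  ext : ∀ ν₁ ν₂ : Measure Y, IsFiniteMeasure ν₁ → IsFiniteMeasure ν₂ →
    ∫ y, f y ∂ν₁ = ∫ y, f y ∂ν₂ → ν₁ = ν₂
  continuous_featureMean : Continuous (featureMean f)

theorem integral_l2Features_apply {φ : ℕ → Y →ᵇ ℝ≥0} (hφ : ∀ n y, φ n y ≤ 1) (ν : Measure Y)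
    [IsFiniteMeasure ν] (n : ℕ) :
    (∫ y, l2Features φ hφ y ∂ν) n = (1 / 2) ^ n * ∫ y, (φ n y : ℝ) ∂ν := by
  let _ : MeasurableSpace ℓ²(ℕ, ℝ) := borel _
  have : BorelSpace ℓ²(ℕ, ℝ) := ⟨rfl⟩
  have h := (lp.evalCLM ℝ (fun _ : ℕ => ℝ) 2 n).integral_comp_comm
    ((l2Features φ hφ).integrable ν)
  rw [← integral_const_mul]
  exact h.symm

theorem isCharacteristic_l2Features {φ : ℕ → Y →ᵇ ℝ≥0} (hφ : ∀ n y, φ n y ≤ 1)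
    (hsep : ∀ ν₁ ν₂ : Measure Y, IsFiniteMeasure ν₁ → IsFiniteMeasure ν₂ →
      (∀ n, ∫⁻ y, φ n y ∂ν₁ = ∫⁻ y, φ n y ∂ν₂) → ν₁ = ν₂) :
    IsCharacteristic (l2Features φ hφ) where
  ext ν₁ ν₂ _ _ h := hsep ν₁ ν₂ inferInstance inferInstance fun n => by
    have hn := congrArg (fun v : ℓ²(ℕ, ℝ) => v n) h
    simp only [integral_l2Features_apply] at hn
    have hint := mul_left_cancel₀ (by positivity) hn
    rw [← (φ n).toReal_lintegral_coe_eq_integral, ← (φ n).toReal_lintegral_coe_eq_integral] at hint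
    exact (ENNReal.toReal_eq_toReal_iff' ((φ n).lintegral_lt_top_of_nnreal ν₁).ne
      ((φ n).lintegral_lt_top_of_nnreal ν₂).ne).1 hint
  continuous_featureMean := by
    refine continuous_lp_of_coord ENNReal.ofNat_ne_top summable_geometric_two (fun n => ?_)
      fun n p => ?_
    · simp only [featureMean, integral_l2Features_apply,
        ← BoundedContinuousFunction.toReal_lintegral_coe_eq_integral]
      exact continuous_const.mul
        (NNReal.continuous_coe.comp (ProbabilityMeasure.continuous_testAgainstNN_eval (φ n)))
    · rw [featureMean, integral_l2Features_apply, ← integral_const_mul]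
      simpa using norm_integral_le_of_norm_le_const
        (ae_of_all (p : Measure Y) (norm_half_pow_mul_le hφ n))

theorem exists_isCharacteristic [SecondCountableTopology Y] [BorelSpace Y]
    [HasOuterApproxClosed Y] : ∃ f : Y →ᵇ ℓ²(ℕ, ℝ), IsCharacteristic f :=
  let ⟨_, hφ, hsep⟩ := exists_seq_boundedContinuousFunction_separating (Y := Y)
  ⟨_, isCharacteristic_l2Features hφ hsep⟩

end FeatureMap

section Kernel

variable {X Y : Type*} [MeasurableSpace X] [MeasurableSpace Y]

/-- The Markov kernel associated with a measurable family of probability measures. -/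
def toKernel (q : X → ProbabilityMeasure Y) (hq : Measurable q) : Kernel X Y :=
  ⟨fun x => q x, measurable_subtype_coe.comp hq⟩

instance (q : X → ProbabilityMeasure Y) (hq : Measurable q) : IsMarkovKernel (toKernel q hq) :=
  ⟨fun x => inferInstanceAs (IsProbabilityMeasure (q x : Measure Y))⟩

theorem isFiniteMeasure_bind (μ : Measure X) [IsFiniteMeasure μ] {q : X → ProbabilityMeasure Y}
    (hq : Measurable q) : IsFiniteMeasure (μ.bind fun x => (q x : Measure Y)) :=
  inferInstanceAs (IsFiniteMeasure (μ.bind (toKernel q hq)))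

end Kernel

section FeatureMean

variable {Y H : Type*} [TopologicalSpace Y] [MeasurableSpace Y] [OpensMeasurableSpace Y]
  [NormedAddCommGroup H] [SecondCountableTopology H]

theorem integrable_feature (f : Y →ᵇ H) (ν : Measure Y) [IsFiniteMeasure ν] : Integrable f ν := by
  borelize H
  exact f.integrable ν

variable [NormedSpace ℝ H]

theorem featureMean_convex_comb (f : Y →ᵇ H) {s t : ℝ≥0} {p q r : ProbabilityMeasure Y}
    (hr : (r : Measure Y) = s • (p : Measure Y) + t • (q : Measure Y)) :
    featureMean f r = s • featureMean f p + t • featureMean f q := by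
  have hint : ∀ p : ProbabilityMeasure Y, Integrable f (p : Measure Y) := fun p =>
    integrable_feature f p
  rw [featureMean, hr, integral_add_measure ((hint p).smul_measure_nnreal)
    ((hint q).smul_measure_nnreal), integral_smul_nnreal_measure, integral_smul_nnreal_measure]
  rfl

theorem sum_featureMean_eq_of_sum_eq (f : Y →ᵇ H) {ι : Type*} {s : Finset ι}
    {p q : ι → ProbabilityMeasure Y}
    (h : ∑ i ∈ s, (p i : Measure Y) = ∑ i ∈ s, (q i : Measure Y)) :
    ∑ i ∈ s, featureMean f (p i) = ∑ i ∈ s, featureMean f (q i) := by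
  have key : ∀ r : ι → ProbabilityMeasure Y, ∑ i ∈ s, featureMean f (r i) =
      ∫ y, f y ∂(∑ i ∈ s, (r i : Measure Y)) := fun r =>
    (integral_finsetSum_measure fun i _ => integrable_feature f (r i)).symm
  rw [key, key, h]

variable {X : Type*} [MeasurableSpace X]

theorem measurable_featureMean_comp [MeasurableSpace H] [BorelSpace H] (f : Y →ᵇ H)
    {q : X → ProbabilityMeasure Y} (hq : Measurable q) :
    Measurable fun x => featureMean f (q x) :=
  (f.continuous.stronglyMeasurable.integral_kernel (κ := toKernel q hq)).measurable

theorem integral_featureMean (f : Y →ᵇ H) (μ : Measure X) [IsFiniteMeasure μ]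
    {q : X → ProbabilityMeasure Y} (hq : Measurable q) :
    ∫ x, featureMean f (q x) ∂μ = ∫ y, f y ∂(μ.bind fun x => (q x : Measure Y)) := by
  have := isFiniteMeasure_bind μ hq
  exact (Kernel.integral_comp (η := toKernel q hq) (κ := Kernel.const Unit μ) (a := ())
    (integrable_feature f (μ.bind fun x => (q x : Measure Y)))).symm

end FeatureMean

section FeatureCost

variable {X Y H : Type*} [TopologicalSpace Y] [MeasurableSpace Y] [NormedAddCommGroup H]
  [NormedSpace ℝ H]

theorem exists_convex_comb {Y : Type*} [MeasurableSpace Y] {s t : ℝ≥0} (hst : s + t = 1)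
    (p q : ProbabilityMeasure Y) :
    ∃ r : ProbabilityMeasure Y, (r : Measure Y) = s • (p : Measure Y) + t • (q : Measure Y) := by
  refine ⟨⟨s • (p : Measure Y) + t • (q : Measure Y), ⟨?_⟩⟩, rfl⟩
  simp only [Measure.add_apply, Measure.smul_apply, measure_univ, ENNReal.smul_def, smul_eq_mul,
    mul_one]
  exact_mod_cast hst

/-- Convexity in the second variable for costs with values in `[0,∞]`. -/
def IsConvexCost {X Y : Type*} [MeasurableSpace Y] (c : X → ProbabilityMeasure Y → ℝ≥0∞) : Prop :=
  ∀ (x : X) (s t : ℝ≥0), s + t = 1 → ∀ p q r : ProbabilityMeasure Y,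
    (r : Measure Y) = s • (p : Measure Y) + t • (q : Measure Y) →
      c x r ≤ s * c x p + t * c x q

/-- Convexity of a set of probability measures. -/
def IsConvexFamily {Y : Type*} [MeasurableSpace Y] (T : Set (ProbabilityMeasure Y)) : Prop :=
  ∀ s t : ℝ≥0, s + t = 1 → ∀ p ∈ T, ∀ q ∈ T, ∀ r : ProbabilityMeasure Y,
    (r : Measure Y) = s • (p : Measure Y) + t • (q : Measure Y) → r ∈ T

/-- The cost on the feature space induced by a cost on a family `T` of probability measures. It is
infinite at the points which are not the mean of an element of `T`. -/
noncomputable def featureCost (f : Y →ᵇ H) (T : Set (ProbabilityMeasure Y))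
    (c : X → ProbabilityMeasure Y → ℝ≥0∞) (x : X) (y : H) : ℝ≥0∞ :=
  ⨅ p ∈ T, (c x p + {z : ProbabilityMeasure Y × H | featureMean f z.1 ≠ z.2}.indicator
    (fun _ => ∞) (p, y))

variable {f : Y →ᵇ H} {T : Set (ProbabilityMeasure Y)} {c : X → ProbabilityMeasure Y → ℝ≥0∞}

theorem exists_featureMean_eq_of_featureCost_ne_top {x : X} {y : H}
    (h : featureCost f T c x y ≠ ∞) : ∃ p ∈ T, featureMean f p = y := by
  by_contra! hne
  refine h ?_
  simp only [featureCost, iInf_eq_top]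
  intro p hp
  simp [hne p hp]

namespace IsCharacteristic

variable [OpensMeasurableSpace Y]

theorem injective_featureMean (hf : IsCharacteristic f) : Function.Injective (featureMean f) :=
  fun _ _ h => ProbabilityMeasure.toMeasure_injective
    (hf.ext _ _ inferInstance inferInstance h)

theorem exists_measurable_lift [BorelSpace Y] [HasOuterApproxClosed Y] [MeasurableSpace H]
    [BorelSpace H] [MeasurableSpace X] (hf : IsCharacteristic f) (hT : IsCompact T) {p : X → H}
    (hp : Measurable p) (hpT : ∀ x, p x ∈ featureMean f '' T) :
    ∃ q : X → ProbabilityMeasure Y, Measurable q ∧ (∀ x, q x ∈ T) ∧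
      ∀ x, featureMean f (q x) = p x := by
  choose q hqT hqp using hpT
  let _ : MeasurableSpace T := borel T
  have : BorelSpace T := ⟨rfl⟩
  have : CompactSpace T := isCompact_iff_compactSpace.1 hT
  have hemb : MeasurableEmbedding fun r : T => featureMean f r :=
    ((hf.continuous_featureMean.comp continuous_subtype_val).isClosedEmbedding
      (hf.injective_featureMean.comp Subtype.val_injective)).measurableEmbedding
  have hq : Measurable fun x => (⟨q x, hqT x⟩ : T) :=
    hemb.measurable_comp_iff.1 (by simpa only [Function.comp_def, hqp] using hp)
  have hval : Measurable[borel T, borel (ProbabilityMeasure Y)] ((↑) : T → ProbabilityMeasure Y) :=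
    continuous_subtype_val.borel_measurable
  exact ⟨q, ((measurable_toMeasure_borel.comp hval).comp hq).subtype_mk, hqT, hqp⟩

theorem lowerSemicontinuous_featureCost [TopologicalSpace X] (hf : IsCharacteristic f)
    (hT : IsCompact T) (hc : LowerSemicontinuous (Function.uncurry c)) :
    LowerSemicontinuous (Function.uncurry (featureCost f T c)) := by
  have hcost : LowerSemicontinuous fun w : (X × H) × ProbabilityMeasure Y => c w.1.1 w.2 :=
    hc.comp (g := fun w : (X × H) × ProbabilityMeasure Y => (w.1.1, w.2)) (by fun_prop)
  have hopen : IsOpen {z : ProbabilityMeasure Y × H | featureMean f z.1 ≠ z.2} :=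
    isOpen_ne_fun (hf.continuous_featureMean.comp continuous_fst) continuous_snd
  have hind := (hopen.lowerSemicontinuous_indicator (y := (∞ : ℝ≥0∞)) zero_le).comp
    (g := fun w : (X × H) × ProbabilityMeasure Y => (w.2, w.1.2)) (by fun_prop)
  exact lowerSemicontinuous_biInf_of_isCompact
    (G := fun (w : X × H) p => c w.1 p +
      {z : ProbabilityMeasure Y × H | featureMean f z.1 ≠ z.2}.indicator (fun _ => ∞) (p, w.2))
    (hcost.add hind) hT

theorem featureCost_featureMean (hf : IsCharacteristic f) {p : ProbabilityMeasure Y}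
    (hp : p ∈ T) (x : X) : featureCost f T c x (featureMean f p) = c x p := by
  refine le_antisymm ((iInf₂_le p hp).trans (by simp)) (le_iInf₂ fun q _ => ?_)
  by_cases h : featureMean f q = featureMean f p
  · rw [hf.injective_featureMean h]
    exact le_self_add
  · simp [h]

theorem convexOn_featureCost [SecondCountableTopology H] (hf : IsCharacteristic f)
    (hT : IsConvexFamily T) (hc : IsConvexCost c) (x : X) :
    ConvexOn ℝ≥0 univ (featureCost f T c x) := by
  refine convexOn_iff_forall_pos.2 ⟨convex_univ, fun y _ z _ s t hs ht hst => ?_⟩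
  simp only [ENNReal.smul_def, smul_eq_mul]
  by_cases hy : featureCost f T c x y = ∞
  · rw [hy, ENNReal.mul_top (by exact_mod_cast hs.ne'), top_add]
    exact le_top
  by_cases hz : featureCost f T c x z = ∞
  · rw [hz, ENNReal.mul_top (by exact_mod_cast ht.ne'), add_top]
    exact le_top
  obtain ⟨p, hp, rfl⟩ := exists_featureMean_eq_of_featureCost_ne_top hy
  obtain ⟨q, hq, rfl⟩ := exists_featureMean_eq_of_featureCost_ne_top hz
  obtain ⟨r, hr⟩ := exists_convex_comb hst p q
  rw [← featureMean_convex_comb f hr, hf.featureCost_featureMean (hT s t hst p hp q hq r hr),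
    hf.featureCost_featureMean hp, hf.featureCost_featureMean hq]
  exact hc x s t hst p q r hr

end IsCharacteristic

end FeatureCost

section OptimalKernel

variable {X Y : Type*} [MeasurableSpace X] [MeasurableSpace Y]

/-- Kernels of finite cost which minimise the cost among all kernels with the same average. -/
structure IsOptimalKernel (μ : Measure X) (c : X → ProbabilityMeasure Y → ℝ≥0∞)
    (q : X → ProbabilityMeasure Y) : Prop where
  measurable : Measurable q
  ne_top : ∫⁻ x, c x (q x) ∂μ ≠ ∞
  le : ∀ r : X → ProbabilityMeasure Y, Measurable r →
    μ.bind (fun x => (r x : Measure Y)) = μ.bind (fun x => (q x : Measure Y)) →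
      ∫⁻ x, c x (q x) ∂μ ≤ ∫⁻ x, c x (r x) ∂μ

variable {μ : Measure X} {c : X → ProbabilityMeasure Y → ℝ≥0∞} {q r : X → ProbabilityMeasure Y}

open scoped Classical in
theorem bind_piecewise (μ : Measure X) {K : Set X} (hK : MeasurableSet K) (hr : Measurable r)
    (hq : Measurable q) :
    μ.bind (fun x => (K.piecewise r q x : Measure Y)) =
      (μ.restrict K).bind (fun x => (r x : Measure Y)) +
        (μ.restrict Kᶜ).bind fun x => (q x : Measure Y) := by
  ext s hs
  have hcoe : ∀ {r : X → ProbabilityMeasure Y}, Measurable r →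
      Measurable fun x => (r x : Measure Y) := fun hr => measurable_subtype_coe.comp hr
  rw [Measure.add_apply, Measure.bind_apply hs (hcoe (hr.piecewise hK hq)).aemeasurable,
    Measure.bind_apply hs (hcoe hr).aemeasurable, Measure.bind_apply hs (hcoe hq).aemeasurable,
    ← lintegral_piecewise hK]
  refine lintegral_congr fun x => ?_
  by_cases hx : x ∈ K <;> simp [hx]

namespace IsOptimalKernel

theorem restrict (h : IsOptimalKernel μ c q) {K : Set X} (hK : MeasurableSet K) :
    IsOptimalKernel (μ.restrict K) c q where
  measurable := h.measurable
  ne_top := ne_top_of_le_ne_top h.ne_top (setLIntegral_le_lintegral _ _)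
  le r hr hbind := by
    classical
    have hsplice := h.le (K.piecewise r q) (hr.piecewise hK h.measurable) <| by
      rw [bind_piecewise μ hK hr h.measurable, hbind,
        ← bind_piecewise μ hK h.measurable h.measurable, piecewise_same]
    have hcost : ∫⁻ x, c x (K.piecewise r q x) ∂μ =
        ∫⁻ x in K, c x (r x) ∂μ + ∫⁻ x in Kᶜ, c x (q x) ∂μ := by
      rw [← lintegral_piecewise hK]
      refine lintegral_congr fun x => ?_
      by_cases hx : x ∈ K <;> simp [hx]
    rw [hcost, ← lintegral_add_compl _ hK] at hsplice
    exact (ENNReal.add_le_add_iff_right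
      (ne_top_of_le_ne_top h.ne_top (setLIntegral_le_lintegral _ _))).1 hsplice

theorem congr_ae (h : IsOptimalKernel μ c q) (hr : Measurable r) (hqr : q =ᵐ[μ] r) :
    IsOptimalKernel μ c r := by
  have hcost : ∫⁻ x, c x (q x) ∂μ = ∫⁻ x, c x (r x) ∂μ :=
    lintegral_congr_ae (hqr.mono fun x hx => congrArg (c x) hx)
  have hbind : μ.bind (fun x => (q x : Measure Y)) = μ.bind fun x => (r x : Measure Y) :=
    Measure.bind_congr_right (hqr.fun_comp _)
  exact ⟨hr, hcost ▸ h.ne_top, fun p hp hpr => hcost ▸ h.le p hp (hpr.trans hbind.symm)⟩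

variable [TopologicalSpace Y] {H : Type*} [NormedAddCommGroup H] [MeasurableSpace H]
  [BorelSpace H] [SecondCountableTopology H] {f : Y →ᵇ H} {T : Set (ProbabilityMeasure Y)}

theorem isMeanMinimizer [NormedSpace ℝ H] [BorelSpace Y] [HasOuterApproxClosed Y]
    [IsFiniteMeasure μ]
    (h : IsOptimalKernel μ c q) (hf : IsCharacteristic f) (hT : IsCompact T) (hqT : ∀ x, q x ∈ T) :
    IsMeanMinimizer μ (featureCost f T c) (featureMean f '' T) fun x => featureMean f (q x) where
  measurable := measurable_featureMean_comp f h.measurable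
  mem x := mem_image_of_mem _ (hqT x)
  ne_top := by simpa only [hf.featureCost_featureMean (hqT _)] using h.ne_top
  le p hp hpT hmean := by
    obtain ⟨r, hr, hrT, hrp⟩ := hf.exists_measurable_lift hT hp hpT
    simp only [← hrp, hf.featureCost_featureMean (hrT _), hf.featureCost_featureMean (hqT _)]
    refine h.le r hr (hf.ext _ _ (isFiniteMeasure_bind μ hr)
      (isFiniteMeasure_bind μ h.measurable) ?_)
    rw [← integral_featureMean f μ hr, ← integral_featureMean f μ h.measurable, ← hmean]
    simp only [hrp]

end IsOptimalKernel

end OptimalKernel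

section Compact

variable {X Y H : Type*} [TopologicalSpace X] [MeasurableSpace X] [OpensMeasurableSpace X]
  [TopologicalSpace Y] [MeasurableSpace Y] [BorelSpace Y] [HasOuterApproxClosed Y]
  [NormedAddCommGroup H] [InnerProductSpace ℝ H] [CompleteSpace H] [MeasurableSpace H]
  [BorelSpace H] [SecondCountableTopology H]
  {μ : Measure X} [IsFiniteMeasure μ] {c : X → ProbabilityMeasure Y → ℝ≥0∞}
  {q : X → ProbabilityMeasure Y} {f : Y →ᵇ H} {T : Set (ProbabilityMeasure Y)}

theorem IsOptimalKernel.exists_monotone_set_of_forall_mem (h : IsOptimalKernel μ c q)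
    (hf : IsCharacteristic f) (hc : LowerSemicontinuous (Function.uncurry c))
    (hconv : IsConvexCost c) (hT : IsCompact T) (hTc : IsConvexFamily T) (hqT : ∀ x, q x ∈ T) :
    ∃ Γ : Set X, MeasurableSet Γ ∧ μ Γᶜ = 0 ∧ ∀ (N : ℕ) (x : Fin N → X), (∀ i, x i ∈ Γ) →
      ∀ m : Fin N → ProbabilityMeasure Y, (∀ i, m i ∈ T) →
        ∑ i, (m i : Measure Y) = ∑ i, (q (x i) : Measure Y) →
        ∑ i, c (x i) (q (x i)) ≤ ∑ i, c (x i) (m i) := by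
  obtain ⟨Γ, hΓ, hΓ0, hmono⟩ := (h.isMeanMinimizer hf hT hqT).exists_monotone_set
    (hf.lowerSemicontinuous_featureCost hT hc) (hf.convexOn_featureCost hTc hconv)
    (hT.image hf.continuous_featureMean) fun x y hy =>
      exists_featureMean_eq_of_featureCost_ne_top hy
  refine ⟨Γ, hΓ, hΓ0, fun N x hx m hm hsum => ?_⟩
  simpa only [hf.featureCost_featureMean (hqT _), hf.featureCost_featureMean (hm _)] using
    hmono N x hx (fun i => featureMean f (m i)) (fun i => mem_image_of_mem _ (hm i))
      (sum_featureMean_eq_of_sum_eq f hsum)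

theorem IsOptimalKernel.exists_monotone_subset (h : IsOptimalKernel μ c q)
    (hf : IsCharacteristic f) (hc : LowerSemicontinuous (Function.uncurry c))
    (hconv : IsConvexCost c) (hT : IsCompact T) (hTc : IsConvexFamily T)
    {K : Set X} (hK : MeasurableSet K) (hKT : ∀ x ∈ K, q x ∈ T) :
    ∃ Γ ⊆ K, MeasurableSet Γ ∧ μ (K \ Γ) = 0 ∧ ∀ (N : ℕ) (x : Fin N → X), (∀ i, x i ∈ Γ) →
      ∀ m : Fin N → ProbabilityMeasure Y, (∀ i, m i ∈ T) →
        ∑ i, (m i : Measure Y) = ∑ i, (q (x i) : Measure Y) →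
        ∑ i, c (x i) (q (x i)) ≤ ∑ i, c (x i) (m i) := by
  classical
  rcases K.eq_empty_or_nonempty with rfl | ⟨x₀, hx₀⟩
  · refine ⟨∅, subset_rfl, MeasurableSet.empty, by simp, fun N x hx m _ _ => ?_⟩
    have : IsEmpty (Fin N) := ⟨fun i => hx i⟩
    simp
  let q' : X → ProbabilityMeasure Y := K.piecewise q fun _ => q x₀
  have hq'K : ∀ x ∈ K, q' x = q x := fun x hx => piecewise_eq_of_mem _ _ _ hx
  have hq'T : ∀ x, q' x ∈ T := fun x => by
    by_cases hx : x ∈ K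
    · rw [hq'K x hx]
      exact hKT x hx
    · rw [show q' x = q x₀ from piecewise_eq_of_notMem _ _ _ hx]
      exact hKT x₀ hx₀
  have hq' : IsOptimalKernel (μ.restrict K) c q' :=
    (h.restrict hK).congr_ae (h.measurable.piecewise hK measurable_const)
      ((ae_restrict_mem hK).mono fun x hx => (hq'K x hx).symm)
  obtain ⟨Γ, hΓ, hΓ0, hmono⟩ := hq'.exists_monotone_set_of_forall_mem hf hc hconv hT hTc hq'T
  refine ⟨Γ ∩ K, inter_subset_right, hΓ.inter hK, ?_, fun N x hx m hm hsum => ?_⟩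
  · rw [Measure.restrict_apply hΓ.compl] at hΓ0
    refine measure_mono_null (fun x hx => ?_) hΓ0
    exact ⟨fun hxΓ => hx.2 ⟨hxΓ, hx.1⟩, hx.1⟩
  · have hqx : ∀ i, q' (x i) = q (x i) := fun i => hq'K _ (hx i).2
    simpa only [hqx] using hmono N x (fun i => (hx i).1) m hm (by simpa only [hqx] using hsum)

end Compact

section Tight

variable {Y : Type*} [MeasurableSpace Y]

/-- The probability measures whose mass outside of `L j` is at most `R 2⁻ʲ`. -/
def tightFamily (L : ℕ → Set Y) (R : ℝ≥0) : Set (ProbabilityMeasure Y) :=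
  {p | ∀ j, p (L j)ᶜ ≤ R * (1 / 2) ^ j}

theorem mem_tightFamily {L : ℕ → Set Y} {R : ℝ≥0} {p : ProbabilityMeasure Y} :
    p ∈ tightFamily L R ↔ ∀ j, (p : Measure Y) (L j)ᶜ ≤ R * (1 / 2) ^ j := by
  refine forall_congr' fun j => ?_
  rw [← ENNReal.coe_le_coe, ProbabilityMeasure.ennreal_coeFn_eq_coeFn_toMeasure]
  push_cast
  simp

theorem tightFamily_mono (L : ℕ → Set Y) : Monotone (tightFamily L) := fun _ _ hR _ hp j =>
  (hp j).trans (by gcongr)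

theorem mem_tightFamily_of_sum_eq {L : ℕ → Set Y} {R : ℝ≥0} {N : ℕ}
    {m p : Fin N → ProbabilityMeasure Y}
    (hsum : ∑ i, (m i : Measure Y) = ∑ i, (p i : Measure Y)) (hp : ∀ i, p i ∈ tightFamily L R)
    (i : Fin N) : m i ∈ tightFamily L (N * R) := by
  refine mem_tightFamily.2 fun j => ?_
  calc (m i : Measure Y) (L j)ᶜ ≤ ∑ i, (m i : Measure Y) (L j)ᶜ :=
        Finset.single_le_sum (f := fun i => (m i : Measure Y) (L j)ᶜ)
          (fun _ _ => zero_le) (Finset.mem_univ i)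
    _ = ∑ i, (p i : Measure Y) (L j)ᶜ := by
        rw [← Measure.finsetSum_apply, hsum, Measure.finsetSum_apply]
    _ ≤ ∑ _i : Fin N, (R : ℝ≥0∞) * (1 / 2) ^ j :=
        Finset.sum_le_sum fun i _ => mem_tightFamily.1 (hp i) j
    _ = ((N * R : ℝ≥0) : ℝ≥0∞) * (1 / 2) ^ j := by
        simp only [Finset.sum_const, Finset.card_univ, Fintype.card_fin, nsmul_eq_mul]
        push_cast
        rw [mul_assoc]

theorem isCompact_tightFamily [TopologicalSpace Y] [T2Space Y] [NormalSpace Y] [BorelSpace Y]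
    {L : ℕ → Set Y} (hL : ∀ j, IsCompact (L j)) (R : ℝ≥0) : IsCompact (tightFamily L R) := by
  refine isCompact_setOfPred_probabilityMeasure_mass_eq_compl_isCompact_le ?_ hL
    (Or.inl inferInstance)
  have h : Tendsto (fun n : ℕ => R * (1 / 2 : ℝ≥0) ^ n) atTop (𝓝 (R * 0)) :=
    (NNReal.tendsto_pow_atTop_nhds_zero_of_lt_one
      (NNReal.half_lt_self one_ne_zero)).const_mul R
  simpa only [mul_zero] using h

theorem isConvexFamily_tightFamily (L : ℕ → Set Y) (R : ℝ≥0) :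
    IsConvexFamily (tightFamily L R) := by
  intro s t hst p hp q hq r hr
  rw [mem_tightFamily] at hp hq ⊢
  intro j
  rw [hr, Measure.add_apply, Measure.smul_apply, Measure.smul_apply, ENNReal.smul_def,
    ENNReal.smul_def, smul_eq_mul, smul_eq_mul]
  calc _ ≤ (s : ℝ≥0∞) * (R * (1 / 2) ^ j) + t * (R * (1 / 2) ^ j) := by
        gcongr
        · exact hp j
        · exact hq j
    _ = R * (1 / 2) ^ j := by
        rw [← add_mul, ← ENNReal.coe_add, hst, ENNReal.coe_one, one_mul]

variable {X : Type*} [MeasurableSpace X]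

theorem measurableSet_preimage_tightFamily {L : ℕ → Set Y} (hL : ∀ j, MeasurableSet (L j))
    (R : ℝ≥0) {q : X → ProbabilityMeasure Y} (hq : Measurable q) :
    MeasurableSet (q ⁻¹' tightFamily L R) := by
  have hmass : ∀ j, Measurable fun x => (q x : Measure Y) (L j)ᶜ := fun j =>
    (Measure.measurable_coe (hL j).compl).comp (measurable_subtype_coe.comp hq)
  simp only [preimage, mem_tightFamily, ofPred_forall]
  exact MeasurableSet.iInter fun j => measurableSet_le (hmass j) measurable_const

theorem ae_exists_mem_tightFamily {μ : Measure X} {q : X → ProbabilityMeasure Y}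
    (hq : Measurable q) {L : ℕ → Set Y} (hL : ∀ j, MeasurableSet (L j))
    (hbind : ∀ j, μ.bind (fun x => (q x : Measure Y)) (L j)ᶜ ≤ (1 / 4) ^ j) :
    ∀ᵐ x ∂μ, ∃ n : ℕ, q x ∈ tightFamily L n := by
  have hcoe : Measurable fun x => (q x : Measure Y) := measurable_subtype_coe.comp hq
  have hmass : ∀ j, Measurable fun x => (q x : Measure Y) (L j)ᶜ := fun j =>
    (Measure.measurable_coe (hL j).compl).comp hcoe
  have hweighted : ∀ j, Measurable fun x => 2 ^ j * (q x : Measure Y) (L j)ᶜ := fun j =>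
    (hmass j).const_mul _
  have hterm : ∀ j, ∫⁻ x, 2 ^ j * (q x : Measure Y) (L j)ᶜ ∂μ ≤ (2⁻¹ : ℝ≥0∞) ^ j := fun j => by
    rw [lintegral_const_mul _ (hmass j), ← Measure.bind_apply (hL j).compl hcoe.aemeasurable]
    calc (2 : ℝ≥0∞) ^ j * μ.bind (fun x => (q x : Measure Y)) (L j)ᶜ
        ≤ 2 ^ j * (1 / 4) ^ j := by gcongr; exact hbind j
      _ = 2⁻¹ ^ j := by
          rw [← mul_pow]
          congr 1
          rw [← ENNReal.toReal_eq_toReal_iff' (by finiteness) (by finiteness)]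
          norm_num
  have hfin : ∫⁻ x, ∑' j, 2 ^ j * (q x : Measure Y) (L j)ᶜ ∂μ ≠ ∞ := by
    rw [lintegral_tsum fun j => (hweighted j).aemeasurable]
    refine ne_top_of_le_ne_top ?_ (ENNReal.tsum_le_tsum hterm)
    simp [ENNReal.tsum_geometric]
  filter_upwards [ae_lt_top (Measurable.tsum hweighted) hfin] with x hx
  obtain ⟨n, hn⟩ := ENNReal.exists_nat_gt hx.ne
  refine ⟨n, mem_tightFamily.2 fun j => ?_⟩
  rw [one_div, ← ENNReal.inv_pow, ← div_eq_mul_inv, ENNReal.le_div_iff_mul_le (by simp) (by simp),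
    mul_comm, ENNReal.coe_natCast]
  exact (ENNReal.le_tsum j).trans hn.le

theorem exists_isCompact_ae_mem_tightFamily [TopologicalSpace Y] [PolishSpace Y] [BorelSpace Y]
    (μ : Measure X) [IsFiniteMeasure μ] {q : X → ProbabilityMeasure Y} (hq : Measurable q) :
    ∃ L : ℕ → Set Y, (∀ j, IsCompact (L j)) ∧ ∀ᵐ x ∂μ, ∃ n : ℕ, q x ∈ tightFamily L n := by
  have := isFiniteMeasure_bind μ hq
  have htight : IsTightMeasureSet {μ.bind fun x => (q x : Measure Y)} :=
    isTightMeasureSet_singleton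
  rw [isTightMeasureSet_iff_exists_isCompact_measure_compl_le] at htight
  choose L hL hLμ using fun j : ℕ => htight ((1 / 4) ^ j) (ENNReal.pow_pos (by simp) j)
  exact ⟨L, hL, ae_exists_mem_tightFamily hq (fun j => (hL j).measurableSet) fun j => hLμ j _ rfl⟩

end Tight

section Polish

variable {X Y : Type*} [TopologicalSpace X] [MeasurableSpace X] [OpensMeasurableSpace X]
  [TopologicalSpace Y] [PolishSpace Y] [MeasurableSpace Y] [BorelSpace Y]
  {μ : Measure X} [IsFiniteMeasure μ] {c : X → ProbabilityMeasure Y → ℝ≥0∞}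
  {q : X → ProbabilityMeasure Y}

theorem aemeasurable_cost (hc : LowerSemicontinuous (Function.uncurry c)) (hq : Measurable q) :
    AEMeasurable (fun x => c x (q x)) μ := by
  obtain ⟨f, hf⟩ := exists_isCharacteristic (Y := Y)
  obtain ⟨L, hL, hae⟩ := exists_isCompact_ae_mem_tightFamily μ hq
  let K : ℕ → Set X := fun n => q ⁻¹' tightFamily L n
  have hK : ∀ n, MeasurableSet (K n) := fun n =>
    measurableSet_preimage_tightFamily (fun j => (hL j).measurableSet) n hq
  have hcover : μ.restrict (⋃ n, K n) = μ :=
    Measure.restrict_eq_self_of_ae_mem (hae.mono fun x hx => mem_iUnion.2 hx)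
  rw [← hcover, aemeasurable_iUnion_iff]
  intro n
  let _ : MeasurableSpace ℓ²(ℕ, ℝ) := borel _
  have : BorelSpace ℓ²(ℕ, ℝ) := ⟨rfl⟩
  have hcost := (hf.lowerSemicontinuous_featureCost (isCompact_tightFamily hL n) hc).measurable
  exact (measurable_comp_graph hcost (measurable_featureMean_comp f hq)).aemeasurable.congr
    ((ae_restrict_mem (hK n)).mono fun x hx => hf.featureCost_featureMean hx x)

theorem IsOptimalKernel.exists_monotone_set (h : IsOptimalKernel μ c q)
    (hc : LowerSemicontinuous (Function.uncurry c)) (hconv : IsConvexCost c) :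
    ∃ Γ : Set X, MeasurableSet Γ ∧ μ Γᶜ = 0 ∧ ∀ (N : ℕ) (x : Fin N → X), (∀ i, x i ∈ Γ) →
      ∀ m : Fin N → ProbabilityMeasure Y,
        ∑ i, (m i : Measure Y) = ∑ i, (q (x i) : Measure Y) →
        ∑ i, c (x i) (q (x i)) ≤ ∑ i, c (x i) (m i) := by
  obtain ⟨f, hf⟩ := exists_isCharacteristic (Y := Y)
  obtain ⟨L, hL, hae⟩ := exists_isCompact_ae_mem_tightFamily μ h.measurable
  let K : ℕ → Set X := fun n => q ⁻¹' tightFamily L n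
  have hKmono : Monotone K := fun n n' hn => preimage_mono (tightFamily_mono L (by gcongr))
  let _ : MeasurableSpace ℓ²(ℕ, ℝ) := borel _
  have : BorelSpace ℓ²(ℕ, ℝ) := ⟨rfl⟩
  -- Competitors at `N ≤ n` points of `K n` only stay in the larger family `tightFamily L (n * n)`.
  choose Γ hΓK hΓ hΓ0 hmono using fun n : ℕ =>
    h.exists_monotone_subset hf hc hconv (isCompact_tightFamily hL (n * n))
      (isConvexFamily_tightFamily L (n * n)) (K := K n)
      (measurableSet_preimage_tightFamily (fun j => (hL j).measurableSet) n h.measurable)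
      fun x hx => tightFamily_mono L (by exact_mod_cast n.le_mul_self) hx
  refine ⟨⋃ n₀, ⋂ n ≥ n₀, Γ n, MeasurableSet.iUnion fun n₀ => MeasurableSet.biInter
    (Set.to_countable _) fun n _ => hΓ n, ?_, fun N x hx m hsum => ?_⟩
  · have hKΓ : ∀ᵐ x ∂μ, ∀ n, x ∈ K n → x ∈ Γ n := ae_all_iff.2 fun n =>
      measure_mono_null (fun _ => Classical.not_imp.1) (hΓ0 n)
    change ∀ᵐ x ∂μ, x ∈ ⋃ n₀, ⋂ n ≥ n₀, Γ n
    filter_upwards [hae, hKΓ] with x ⟨n₀, hn₀⟩ hx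
    exact mem_iUnion.2 ⟨n₀, mem_iInter₂.2 fun n hn => hx n (hKmono hn hn₀)⟩
  · simp only [mem_iUnion, mem_iInter] at hx
    choose n₀ hn₀ using hx
    let n : ℕ := max N (Finset.univ.sup n₀)
    have hxn : ∀ i, x i ∈ Γ n := fun i =>
      hn₀ i n ((Finset.le_sup (Finset.mem_univ i)).trans (le_max_right _ _))
    have hN : (N : ℝ≥0) * n ≤ n * n := by
      gcongr
      exact le_max_left _ _
    exact hmono n N x hxn m (fun i => tightFamily_mono L hN
      (mem_tightFamily_of_sum_eq hsum (fun i => hΓK n (hxn i)) i)) hsum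

end Polish

section EReal

theorem coe_ennreal_finset_sum {ι : Type*} (s : Finset ι) (u : ι → ℝ≥0∞) :
    ((∑ i ∈ s, u i : ℝ≥0∞) : EReal) = ∑ i ∈ s, (u i : EReal) :=
  map_sum (⟨⟨(↑), EReal.coe_ennreal_zero⟩, EReal.coe_ennreal_add⟩ : ℝ≥0∞ →+ EReal) u s

theorem coe_ennreal_sub_eq_sub {a b d e : ℝ≥0∞} (hd : d ≠ ∞) (he : e ≠ ∞) (h : a + e = b + d) :
    (a : EReal) - d = b - e := by
  lift d to ℝ≥0 using hd
  lift e to ℝ≥0 using he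
  have h' : (a : EReal) + (e : ℝ) = b + (d : ℝ) := by
    simpa only [EReal.coe_ennreal_add, EReal.coe_nnreal_eq_coe_real] using
      congrArg ((↑) : ℝ≥0∞ → EReal) h
  calc (a : EReal) - (d : ℝ) = a + (e : ℝ) - (e : ℝ) - (d : ℝ) := by
        rw [EReal.add_sub_cancel_right]
    _ = b + (d : ℝ) - (d : ℝ) - (e : ℝ) := by
        rw [h', sub_eq_add_neg, sub_eq_add_neg, sub_eq_add_neg, sub_eq_add_neg, add_right_comm]
    _ = b - (e : ℝ) := by rw [EReal.add_sub_cancel_right]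

theorem coe_ennreal_sub_le_sub_iff {a b m : ℝ≥0∞} (hm : m ≠ ∞) :
    (a : EReal) - m ≤ b - m ↔ a ≤ b := by
  lift m to ℝ≥0 using hm
  rw [EReal.coe_nnreal_eq_coe_real, EReal.sub_le_iff_le_add (Or.inl (EReal.coe_ne_bot m))
    (Or.inl (EReal.coe_ne_top m)), EReal.sub_add_cancel, EReal.coe_ennreal_le_coe_ennreal_iff]

theorem ne_top_of_coe_ennreal_sub_lt_top {a m : ℝ≥0∞} (hm : m ≠ ∞)
    (h : (a : EReal) - m < ⊤) : a ≠ ∞ := by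
  rintro rfl
  lift m to ℝ≥0 using hm
  exact h.ne (EReal.top_sub_coe m)

theorem lowerSemicontinuous_toENNReal_add_coe {α : Type*} [TopologicalSpace α] {g : α → EReal}
    (hg : LowerSemicontinuous g) (β : ℝ) :
    LowerSemicontinuous fun x => (g x + β).toENNReal := by
  have hadd : Continuous fun e : EReal => e + (β : EReal) := continuous_iff_continuousAt.2 fun e =>
    (EReal.continuousAt_add (p := (e, (β : EReal))) (Or.inr (EReal.coe_ne_bot β))
      (Or.inr (EReal.coe_ne_top β))).comp (f := fun e : EReal => (e, (β : EReal))) (by fun_prop)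
  exact (EReal.continuous_toENNReal.comp hadd).comp_lowerSemicontinuous hg fun e e' he =>
    EReal.toENNReal_le_toENNReal (add_le_add_left he _)

theorem toENNReal_add_coe_le_convex_comb {s t : ℝ≥0} (hst : s + t = 1) {a b d : EReal} {β : ℝ}
    (h : a ≤ (s : ℝ) * b + (t : ℝ) * d) (hb : 0 ≤ b + β) (hd : 0 ≤ d + β) :
    (a + β).toENNReal ≤ s * (b + β).toENNReal + t * (d + β).toENNReal := by
  have hmul : ∀ (r : ℝ≥0) (e : EReal), 0 ≤ e + β →
      (((r : ℝ≥0∞) * (e + β).toENNReal : ℝ≥0∞) : EReal) = (r : ℝ) * e + ((r * β : ℝ) : EReal) :=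
    fun r e he => by
      rw [EReal.coe_ennreal_mul, EReal.coe_toENNReal he, EReal.coe_mul]
      exact EReal.left_distrib_of_nonneg_of_ne_top (EReal.coe_nonneg.2 r.2) (EReal.coe_ne_top _) _ _
  have hβ : ((s * β : ℝ) : EReal) + ((t * β : ℝ) : EReal) = β := by
    have hst' : (s : ℝ) + t = 1 := by exact_mod_cast hst
    rw [← EReal.coe_add, ← add_mul, hst', one_mul]
  rw [← EReal.toENNReal_coe (x := _ + _)]
  refine EReal.toENNReal_le_toENNReal ?_
  rw [EReal.coe_ennreal_add, hmul s b hb, hmul t d hd, add_add_add_comm, hβ]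
  gcongr

theorem eintegral_coe_sub {X : Type*} [MeasurableSpace X] {h : X → ℝ≥0∞} {μ : Measure X}
    [IsFiniteMeasure μ] (hh : AEMeasurable h μ) (β : ℝ≥0) :
    eintegral (fun x => (h x : EReal) - ((β : ℝ≥0∞) : EReal)) μ =
      ((∫⁻ x, h x ∂μ : ℝ≥0∞) : EReal) - ((β * μ univ : ℝ≥0∞) : EReal) := by
  have hpos : ∀ x, ((h x : EReal) - ((β : ℝ≥0∞) : EReal)).toENNReal = h x - β := fun x => by
    rw [EReal.toENNReal_sub (EReal.coe_ennreal_nonneg _), EReal.toENNReal_coe,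
      EReal.toENNReal_coe]
  have hneg : ∀ x, (-((h x : EReal) - ((β : ℝ≥0∞) : EReal))).toENNReal = β - h x := fun x => by
    rw [EReal.neg_sub (Or.inr (by simp)) (Or.inr (by simp)), add_comm,
      ← sub_eq_add_neg, EReal.toENNReal_sub (EReal.coe_ennreal_nonneg _), EReal.toENNReal_coe,
      EReal.toENNReal_coe]
  have hmass : (β : ℝ≥0∞) * μ univ ≠ ∞ :=
    ENNReal.mul_ne_top ENNReal.coe_ne_top (measure_ne_top _ _)
  simp only [eintegral, hpos, hneg]
  refine coe_ennreal_sub_eq_sub (ne_top_of_le_ne_top hmass ?_) hmass ?_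
  · rw [← lintegral_const]
    exact lintegral_mono fun x => tsub_le_self
  · rw [← lintegral_const, ← lintegral_add_right _ measurable_const, ← lintegral_add_left' hh]
    exact lintegral_congr fun x => tsub_add_eq_max.trans add_tsub_eq_max.symm

end EReal

section WeakCost

variable {X₁ X₂ : Type*} [TopologicalSpace X₁] [TopologicalSpace X₂] [MeasurableSpace X₂]
  [BorelSpace X₂] {C : X₁ → ProbabilityMeasure X₂ → EReal}

theorem IsWeakCost.exists_nonneg (hC : IsWeakCost C) :
    ∃ (β : ℝ≥0) (c : X₁ → ProbabilityMeasure X₂ → ℝ≥0∞),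
      LowerSemicontinuous (Function.uncurry c) ∧ IsConvexCost c ∧
      ∀ x p, C x p = (c x p : EReal) - ((β : ℝ≥0∞) : EReal) := by
  obtain ⟨b, hb⟩ := hC.bddBelow
  let β : ℝ≥0 := (-b).toNNReal
  have hbβ : (0 : ℝ) ≤ b + β := by linarith [Real.le_coe_toNNReal (-b)]
  have hβ : ∀ x p, 0 ≤ C x p + ((β : ℝ) : EReal) := fun x p =>
    calc (0 : EReal) ≤ b + ((β : ℝ) : EReal) := by exact_mod_cast hbβ
      _ ≤ C x p + ((β : ℝ) : EReal) := by gcongr; exact hb x p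
  refine ⟨β, fun x p => (C x p + ((β : ℝ) : EReal)).toENNReal,
    lowerSemicontinuous_toENNReal_add_coe hC.lsc β, fun x s t hst p q r hr =>
      toENNReal_add_coe_le_convex_comb hst (hC.convex x s t hst p q r hr) (hβ x p) (hβ x q),
    fun x p => ?_⟩
  rw [EReal.coe_toENNReal (hβ x p)]
  exact EReal.add_sub_cancel_right.symm

end WeakCost

section Plan

variable {X₁ X₂ : Type*} [MeasurableSpace X₁]
  [TopologicalSpace X₂] [PolishSpace X₂] [MeasurableSpace X₂] [BorelSpace X₂] [Nonempty X₂]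

theorem measurable_disint (γ : FiniteMeasure (X₁ × X₂)) : Measurable (disint γ) :=
  (γ : Measure (X₁ × X₂)).condKernel.measurable.subtype_mk

theorem bind_disint (γ : FiniteMeasure (X₁ × X₂)) :
    (γ : Measure (X₁ × X₂)).fst.bind (fun x => (disint γ x : Measure X₂)) =
      (γ : Measure (X₁ × X₂)).snd := by
  conv_rhs => rw [← (γ : Measure (X₁ × X₂)).disintegrate (γ : Measure (X₁ × X₂)).condKernel]
  rw [Measure.snd_compProd]
  rfl

theorem exists_plan_disint_ae_eq (μ : Measure X₁) [IsFiniteMeasure μ]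
    {q : X₁ → ProbabilityMeasure X₂} (hq : Measurable q) :
    ∃ γ : FiniteMeasure (X₁ × X₂), (γ : Measure (X₁ × X₂)).fst = μ ∧
      (γ : Measure (X₁ × X₂)).snd = μ.bind (fun x => (q x : Measure X₂)) ∧ disint γ =ᵐ[μ] q := by
  have hfst : (μ.compProd (toKernel q hq)).fst = μ := Measure.fst_compProd μ _
  refine ⟨⟨μ.compProd (toKernel q hq), inferInstance⟩, hfst, Measure.snd_compProd μ _, ?_⟩
  have h := eq_condKernel_of_measure_eq_compProd (ρ := μ.compProd (toKernel q hq))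
    (toKernel q hq) (by rw [hfst])
  rw [hfst] at h
  filter_upwards [h] with x hx
  exact Subtype.ext hx.symm

variable [TopologicalSpace X₁] [OpensMeasurableSpace X₁] {F₁ F₂ : ℝ≥0 → ℝ≥0∞}
  {C : X₁ → ProbabilityMeasure X₂ → EReal} {μ₁ : FiniteMeasure X₁} {μ₂ : FiniteMeasure X₂}
  {γ : FiniteMeasure (X₁ × X₂)} {β : ℝ≥0} {c : X₁ → ProbabilityMeasure X₂ → ℝ≥0∞}

theorem energy_eq_coe_sub (hc : LowerSemicontinuous (Function.uncurry c))
    (hCc : ∀ x p, C x p = (c x p : EReal) - ((β : ℝ≥0∞) : EReal))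
    (γ : FiniteMeasure (X₁ × X₂)) :
    energy F₁ F₂ C μ₁ μ₂ γ =
      ((entropy F₁ (γ : Measure (X₁ × X₂)).fst μ₁ + entropy F₂ (γ : Measure (X₁ × X₂)).snd μ₂ +
        ∫⁻ x, c x (disint γ x) ∂(γ : Measure (X₁ × X₂)).fst : ℝ≥0∞) : EReal) -
        ((β * (γ : Measure (X₁ × X₂)).fst univ : ℝ≥0∞) : EReal) := by
  simp only [energy, hCc]
  rw [eintegral_coe_sub (aemeasurable_cost hc (measurable_disint γ)), EReal.coe_ennreal_add,
    EReal.coe_ennreal_add, sub_eq_add_neg, sub_eq_add_neg, add_assoc _ _ (-_)]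

theorem IsOptimalPlan.isOptimalKernel (hγ : IsOptimalPlan F₁ F₂ C μ₁ μ₂ γ)
    (hfeas : IsFeasible F₁ F₂ C μ₁ μ₂) (hc : LowerSemicontinuous (Function.uncurry c))
    (hCc : ∀ x p, C x p = (c x p : EReal) - ((β : ℝ≥0∞) : EReal)) :
    IsOptimalKernel (γ : Measure (X₁ × X₂)).fst c (disint γ) := by
  have hmass : (β : ℝ≥0∞) * (γ : Measure (X₁ × X₂)).fst univ ≠ ∞ :=
    ENNReal.mul_ne_top ENNReal.coe_ne_top (measure_ne_top _ _)
  have hle : ∀ γ', energy F₁ F₂ C μ₁ μ₂ γ ≤ energy F₁ F₂ C μ₁ μ₂ γ' := fun γ' =>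
    hγ.trans_le (iInf_le _ γ')
  have hlt : energy F₁ F₂ C μ₁ μ₂ γ < ⊤ := hfeas.elim fun γ' hγ' => (hle γ').trans_lt hγ'
  rw [energy_eq_coe_sub hc hCc] at hlt
  obtain ⟨hentropy, hcost⟩ := ENNReal.add_ne_top.1 (ne_top_of_coe_ennreal_sub_lt_top hmass hlt)
  refine ⟨measurable_disint γ, hcost, fun q hq hbind => ?_⟩
  obtain ⟨γ', hfst, hsnd, hdisint⟩ := exists_plan_disint_ae_eq (γ : Measure (X₁ × X₂)).fst hq
  have hcost' : ∫⁻ x, c x (disint γ' x) ∂(γ : Measure (X₁ × X₂)).fst =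
      ∫⁻ x, c x (q x) ∂(γ : Measure (X₁ × X₂)).fst :=
    lintegral_congr_ae (hdisint.mono fun x hx => congrArg (c x) hx)
  have h := hle γ'
  rw [energy_eq_coe_sub hc hCc, energy_eq_coe_sub hc hCc, hfst, hsnd, hbind, bind_disint,
    hcost', coe_ennreal_sub_le_sub_iff hmass] at h
  exact (ENNReal.add_le_add_iff_left hentropy).1 h

end Plan

end WOET

theorem mainTheorem5_general {X₁ X₂ : Type*}
    [TopologicalSpace X₁] [MeasurableSpace X₁] [OpensMeasurableSpace X₁]
    [TopologicalSpace X₂] [PolishSpace X₂] [MeasurableSpace X₂] [BorelSpace X₂] [Nonempty X₂]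
    {F₁ F₂ : ℝ≥0 → ℝ≥0∞} {C : X₁ → ProbabilityMeasure X₂ → EReal} (hC : WOET.IsWeakCost C)
    {μ₁ : FiniteMeasure X₁} {μ₂ : FiniteMeasure X₂} (hfeas : WOET.IsFeasible F₁ F₂ C μ₁ μ₂)
    {γ : FiniteMeasure (X₁ × X₂)} (hγ : WOET.IsOptimalPlan F₁ F₂ C μ₁ μ₂ γ) :
    WOET.IsCMonotone C γ := by
  obtain ⟨β, c, hc, hconv, hCc⟩ := hC.exists_nonneg
  obtain ⟨Γ, hΓ, hΓ0, hmono⟩ :=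
    (hγ.isOptimalKernel hfeas hc hCc).exists_monotone_set hc hconv
  refine ⟨Γ, hΓ, hΓ0, fun N x hx m hsum => ?_⟩
  simp only [hCc, sub_eq_add_neg, Finset.sum_add_distrib, ← WOET.coe_ennreal_finset_sum]
  gcongr
  exact EReal.coe_ennreal_le_coe_ennreal_iff.2 (hmono N x hx m hsum)

theorem mainTheorem5 {X₁ X₂ : Type*}
    [TopologicalSpace X₁] [PolishSpace X₁] [MeasurableSpace X₁] [BorelSpace X₁]
    [TopologicalSpace X₂] [PolishSpace X₂] [MeasurableSpace X₂] [BorelSpace X₂] [Nonempty X₂]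
    (F₁ F₂ : ℝ≥0 → ℝ≥0∞) (hF₁ : WOET.IsAdmissible F₁) (hF₂ : WOET.IsAdmissible F₂)
    (C : X₁ → ProbabilityMeasure X₂ → EReal) (hC : WOET.IsWeakCost C)
    (μ₁ : FiniteMeasure X₁) (μ₂ : FiniteMeasure X₂)
    (hfeas : WOET.IsFeasible F₁ F₂ C μ₁ μ₂) (hcoer : WOET.IsCoercive F₁ F₂ C)
    (γ : FiniteMeasure (X₁ × X₂)) (hγ : WOET.IsOptimalPlan F₁ F₂ C μ₁ μ₂ γ) :
    WOET.IsCMonotone C γ :=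
  mainTheorem5_general hC hfeas hγ
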